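/- Let $\mathbb T=\mathbb R/2\pi\mathbb Z$, $\Omega=\mathbb T^2\times(-1,1)$, $\Gamma=\mathbb T^2\times\{\pm1\}$ with outward unit normal $\nu$. Consider the Stokes eigenvalue problem with frictionless Navier conditions ($\beta=0$) $$-\Delta u+\nabla q=\lambda u,\quad \nabla\cdot u=0\ \text{ in }\Omega,\qquad u\cdot\nu=0,\quad 2(\mathbb Du\cdot\nu)\cdot\tau=0\ \text{ on }\Gamma \text{ for all tangential vectors } \tau,$$ where $\mathbb Du=\frac12(\nabla u+\nabla^{\top}u)$. Let $V=\{v\in H^1(\Omega)^3:\nabla\cdot v=0,\ v\cdot\nu=0\text{ on }\Gamma\}$. A number $\lambda\in\mathbb R$ is an eigenvalue, and $0\neq u\in V$ an eigenfunction, if $2\int_\Omega\mathbb Du:\mathbb D\varphi=\lambda\int_\Omega u\cdot\varphi$ for all $\varphi\in V$; a function $q\in L^2(\Omega)$ is an associated pressure if $-\Delta u+\nabla q=\lambda u$ in the sense of distributions in $\Omega$. For $m,n,p\in\mathbb N=\{0,1,2,\dots\}$ put $\mu=\sqrt{m^2+n^2}$ and $$\lambda^N_{m,n,p}=\mu^2+\frac{\pi^2}{4}p^2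 .$$ For $a,b,c,d\in\mathbb R$ put $$\begin{aligned} \mathcal P^u_{m,n}&=a\cos(mx)\sin(ny)-b\sin(mx)\sin(ny)-c\sin(mx)\cos(ny)+d\cos(mx)\cos(ny),\\ \mathcal P^v_{m,n}&=a\sin(mx)\cos(ny)+b\cos(mx)\cos(ny)-c\cos(mx)\sin(ny)-d\sin(mx)\sin(ny),\\ \mathcal P_{m,n}&=a\sin(mx)\sin(ny)+b\cos(mx)\sin(ny)+c\cos(mx)\cos(ny)+d\sin(mx)\cos(ny), \end{aligned}$$ and let $E_{m,n,p}$ be the linear span in $L^2(\Omega)^3$ of all the fields $$\big(\mathcal U(z)\mathcal P^u_{m,n}(x,y),\ \mathcal V(z)\mathcal P^v_{m,n}(x,y),\ \mathcal W(z)\mathcal P_{m,n}(x,y)\big),\qquad m\,\mathcal U+n\,\mathcal V=\mathcal W',\tag{1}$$ with $a,b,c,d\in\mathbb R$ and trigonometric profiles: $\mathcal U,\mathcal V$ are multiples of $\cos(\frac\pi2pz)$ and $\mathcal W$ is a multiple of $\sin(\frac\pi2pz)$ if $p$ is even; $\mathcal U,\mathcal V$ are multiples of $\sin(\frac\pi2pz)$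 and $\mathcal W$ is a multiple of $\cos(\frac\pi2pz)$ if $p$ is odd. Then: 1. For all $m,n$ the sequence $(\lambda^N_{m,n,p})_{p\in\mathbb N}$ is non-negative, increasing and divergent, and it consists of eigenvalues. There are no other eigenvalues: $\lambda\in\mathbb R$ is an eigenvalue if and only if $\lambda=\lambda^N_{m,n,p}$ for some $m,n,p\in\mathbb N$. 2. For every $\lambda\in\mathbb R$, the set of solutions $u\in V$ of the weak problem (the eigenfunctions and $0$) is the sum of the spaces $E_{m,n,p}$ over the finitely many $(m,n,p)$ with $\lambda^N_{m,n,p}=\lambda$. The spaces $E_{m,n,p}$ are linearly independent, so this sum is direct, and $\dim E_{0,0,p}=2$; if exactly one of $m,n$ is $0$, $\dim E_{m,n,0}=2$ and $\dim E_{m,n,p}=4$ for $p\ge1$; if $m,n\ge1$, $\dim E_{m,n,0}=4$ and $\dim E_{m,n,p}=8$ for $p\ge1$. 3. The pressure is always constant: for every eigenfunction $u$, the associated pressures $q$ are exactly the functions that are constant a.e. in $\Omega$. 4. The fields (1) are smooth up to the boundary and, with $\lambda=\lambda^N_{m,n,p}$ and $q$ any constant, satisfy all the equations and boundary conditions of the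 problem pointwise. -/

import Mathlib

open Real MeasureTheory Filter Topology
open scoped ContDiff

namespace StokesChannel

noncomputable section

/-! ### The channel `Ω = 𝕋² × (-1, 1)`, with `𝕋 = ℝ / 2πℤ`

Functions on `𝕋² × ℝ` are functions of `(x, y, z) ∈ ℝ × ℝ × ℝ` that are `2π`-periodic in `x` and
in `y`; integrals over `Ω` are integrals over one period cell. -/

/-- The space of the coordinates `(x, y, z)`. -/
abbrev Pt : Type := ℝ × ℝ × ℝ

/-- Lebesgue measure on `Ω`, realised on the period cell `(0, 2π] × (0, 2π] × (-1, 1)`. -/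
def volΩ : Measure Pt :=
  volume.restrict (Set.Ioc 0 (2 * π) ×ˢ Set.Ioc 0 (2 * π) ×ˢ Set.Ioo (-1) 1)

/-- `L²(Ω)`. An element, extended periodically, is an `L²` function on `𝕋² × (-1, 1)`. -/
abbrev L2 : Type := Lp ℝ 2 volΩ

/-- `L²(Ω)³`. -/
abbrev L2Field : Type := Fin 3 → L2

/-- The coordinate vectors of the `x`, `y` and `z` axes. -/
def e : Fin 3 → Pt := ![(1, 0, 0), (0, 1, 0), (0, 0, 1)]

/-- The classical partial derivative `∂ᵢ f`. -/
def pd (i : Fin 3) (f : Pt → ℝ) : Pt → ℝ := fun X => fderiv ℝ f X (e i)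

/-- The classical Laplacian. -/
def lap (f : Pt → ℝ) : Pt → ℝ := fun X => ∑ j, pd j (pd j f) X

/-- `2π`-periodicity in `x` and in `y`. -/
def IsPeriodic (f : Pt → ℝ) : Prop :=
  ∀ x y z : ℝ, f (x + 2 * π, y, z) = f (x, y, z) ∧ f (x, y + 2 * π, z) = f (x, y, z)

/-- Functions that are smooth up to the boundary of `Ω`. -/
def IsSmooth (f : Pt → ℝ) : Prop := ContDiff ℝ ∞ f ∧ IsPeriodic f

/-- Test functions: smooth, with compact support in `Ω = 𝕋² × (-1, 1)`. -/
def IsTest (f : Pt → ℝ) : Prop :=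
  IsSmooth f ∧ ∃ r : ℝ, r < 1 ∧ ∀ x y z : ℝ, r < |z| → f (x, y, z) = 0

/-! ### Function spaces -/

/-- `g` is the weak partial derivative `∂ᵢ f` in `Ω`. -/
def IsWeakPartial (i : Fin 3) (f g : L2) : Prop :=
  ∀ φ : Pt → ℝ, IsTest φ → ∫ X, f X * pd i φ X ∂volΩ = -∫ X, g X * φ X ∂volΩ

/-- `G i j` is the weak derivative `∂ⱼ uᵢ`, that is, `u ∈ H¹(Ω)³` and `G` is its gradient. -/
def IsWeakGrad (u : L2Field) (G : Fin 3 → Fin 3 → L2) : Prop :=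
  ∀ i j, IsWeakPartial j (u i) (G i j)

/-- `∇ · u = 0` in `Ω`, in the sense of distributions. -/
def IsDivFree (u : L2Field) : Prop :=
  ∀ ψ : Pt → ℝ, IsTest ψ → ∑ i, ∫ X, u i X * pd i ψ X ∂volΩ = 0

/-- For a field with `∇ · u = 0`: the normal trace `u · ν` on `Γ = 𝕋² × {-1, 1}`, which is given by
Green's formula `⟨u · ν, ψ⟩ = ∫ u · ∇ψ + ∫ (∇ · u) ψ`, vanishes. -/
def HasZeroNormalTrace (u : L2Field) : Prop :=
  ∀ ψ : Pt → ℝ, IsSmooth ψ → ∑ i, ∫ X, u i X * pd i ψ X ∂volΩ = 0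

/-- The space `H = {u ∈ L²(Ω)³ : ∇ · u = 0 in Ω, u · ν = 0 on Γ}`. -/
def MemH (u : L2Field) : Prop := IsDivFree u ∧ HasZeroNormalTrace u

/-- The space `V = H¹(Ω)³ ∩ H`. -/
def MemV (u : L2Field) : Prop := MemH u ∧ ∃ G, IsWeakGrad u G

/-- The strain tensor of a field with weak gradient `G`. -/
def strain (G : Fin 3 → Fin 3 → L2) (i j : Fin 3) : L2 := (1 / 2 : ℝ) • (G i j + G j i)

/-! ### The Stokes eigenvalue problem with frictionless Navier conditions (`β = 0`) -/

/-- `u ∈ V` and `2 (𝔻u, 𝔻φ) = l (u, φ)` for all `φ ∈ V`. -/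
def IsWeakSolution (l : ℝ) (u : L2Field) : Prop :=
  MemV u ∧ ∃ G, IsWeakGrad u G ∧ ∀ φ : L2Field, MemV φ → ∀ Φ, IsWeakGrad φ Φ →
    2 * ∑ i, ∑ j, ∫ X, strain G i j X * strain Φ i j X ∂volΩ
      = l * ∑ i, ∫ X, u i X * φ i X ∂volΩ

/-- Eigenfunctions are the nonzero weak solutions. -/
def IsEigenfunction (l : ℝ) (u : L2Field) : Prop := u ≠ 0 ∧ IsWeakSolution l u

/-- The eigenvalues of the Stokes problem. -/
def IsEigenvalue (l : ℝ) : Prop := ∃ u, IsEigenfunction l u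

/-- `q` is a pressure of `u`: `-Δu + ∇q = l u` in `Ω`, in the sense of distributions. -/
def IsPressure (l : ℝ) (u : L2Field) (q : L2) : Prop :=
  ∀ φ : Fin 3 → Pt → ℝ, (∀ i, IsTest (φ i)) →
    -(∑ i, ∫ X, u i X * lap (φ i) X ∂volΩ) - ∫ X, q X * (∑ i, pd i (φ i) X) ∂volΩ
      = l * ∑ i, ∫ X, u i X * φ i X ∂volΩ

/-- The outward unit normal `(0, 0, z)` at a point of `Γ`, where `z = ±1`. -/
def nu (X : Pt) : Fin 3 → ℝ := ![0, 0, X.2.2]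

/-- Classical solutions, smooth up to the boundary, of the Stokes eigenvalue problem with friction
coefficient `β`. The tangential vectors are those of the `x` and `y` axes. -/
structure IsClassicalSolution (β l : ℝ) (u : Fin 3 → Pt → ℝ) (q : Pt → ℝ) : Prop where
  smooth_u : ∀ i, IsSmooth (u i)
  smooth_q : IsSmooth q
  momentum : ∀ X : Pt, |X.2.2| < 1 → ∀ i, -lap (u i) X + pd i q X = l * u i X
  divergence : ∀ X : Pt, |X.2.2| < 1 → ∑ i, pd i (u i) X = 0
  normal : ∀ X : Pt, |X.2.2| = 1 → ∑ i, u i X * nu X i = 0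
  tangential : ∀ X : Pt, |X.2.2| = 1 → ∀ j : Fin 3, j ≠ 2 →
    2 * ∑ k, (pd k (u j) X + pd j (u k) X) / 2 * nu X k + β * u j X = 0

/-! ### The eigenvalues and the separated eigenfunctions -/

/-- `μ = √(m² + n²)`. -/
def mu (m n : ℕ) : ℝ := √((m : ℝ) ^ 2 + (n : ℝ) ^ 2)

/-- `λ_{m,n,p} = μ² + π² p² / 4`. -/
def eigenvalueN (m n p : ℕ) : ℝ := mu m n ^ 2 + π ^ 2 / 4 * (p : ℝ) ^ 2

/-- The periodic factor of the first component. -/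
def Pu (m n : ℕ) (a b c d x y : ℝ) : ℝ :=
  a * cos (m * x) * sin (n * y) - b * sin (m * x) * sin (n * y)
    - c * sin (m * x) * cos (n * y) + d * cos (m * x) * cos (n * y)

/-- The periodic factor of the second component. -/
def Pv (m n : ℕ) (a b c d x y : ℝ) : ℝ :=
  a * sin (m * x) * cos (n * y) + b * cos (m * x) * cos (n * y)
    - c * cos (m * x) * sin (n * y) - d * sin (m * x) * sin (n * y)

/-- The periodic factor of the third component. -/
def Pw (m n : ℕ) (a b c d x y : ℝ) : ℝ :=
  a * sin (m * x) * sin (n * y) + b * cos (m * x) * sin (n * y)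
    + c * cos (m * x) * cos (n * y) + d * sin (m * x) * cos (n * y)

/-- Vertical profile of the horizontal components: `cos (π p z / 2)` for even `p` and
`sin (π p z / 2)` for odd `p`. -/
def hProfile (p : ℕ) (z : ℝ) : ℝ := if Even p then cos (π / 2 * p * z) else sin (π / 2 * p * z)

/-- Vertical profile of the vertical component: `sin (π p z / 2)` for even `p` and
`cos (π p z / 2)` for odd `p`. -/
def vProfile (p : ℕ) (z : ℝ) : ℝ := if Even p then sin (π / 2 * p * z) else cos (π / 2 * p * z)

/-- The field `(𝒰(z) 𝒫ᵘ(x,y), 𝒱(z) 𝒫ᵛ(x,y), 𝒲(z) 𝒫(x,y))` with the trigonometric profiles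
`𝒰 = U * hProfile p`, `𝒱 = V * hProfile p`, `𝒲 = W * vProfile p`. -/
def sepField (m n p : ℕ) (a b c d U V W : ℝ) : Fin 3 → Pt → ℝ :=
  ![fun X => U * hProfile p X.2.2 * Pu m n a b c d X.1 X.2.1,
    fun X => V * hProfile p X.2.2 * Pv m n a b c d X.1 X.2.1,
    fun X => W * vProfile p X.2.2 * Pw m n a b c d X.1 X.2.1]

/-- The relation `m 𝒰 + n 𝒱 = 𝒲'` between the amplitudes of the profiles. -/
def AmplitudeRel (m n p : ℕ) (U V W : ℝ) : Prop :=
  m * U + n * V = (if Even p then 1 else -1) * (π / 2 * p) * W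

/-- The span in `L²(Ω)³` of the separated fields with indices `(m, n, p)`. -/
def sepSpace (m n p : ℕ) : Submodule ℝ L2Field :=
  Submodule.span ℝ {u | ∃ a b c d U V W : ℝ, AmplitudeRel m n p U V W ∧
    ∀ i, u i =ᵐ[volΩ] sepField m n p a b c d U V W i}

/-- The number of linearly independent eigenfunctions with indices `(m, n, p)`. -/
def multN (m n p : ℕ) : ℕ :=
  if m = 0 ∧ n = 0 then 2
  else (if m = 0 ∨ n = 0 then 1 else 2) * (if p = 0 then 2 else 4)

end

end StokesChannel

open StokesChannel

namespace StokesChannel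

/-! The trigonometric fields diagonalise the problem explicitly, so neither regularity theory nor a
compactness argument is needed.

Each component of a separated field is an eigenfunction of the Laplacian for the same number
`eigenvalueN m n p`, the amplitude relation says that the divergence vanishes, and the parity rule
makes `vProfile p` vanish at `z = ±1`. Since the derivative of `hProfile p` is a multiple of
`vProfile p`, the tangential stress vanishes as well. So these fields are classical solutions with
constant pressure, and integration by parts turns them into weak ones
(`IsClassicalSolution.isWeakSolution`). The test fields in `V` are only weakly differentiable, with
a normal trace defined by duality; boundary terms are handled by a cutoff in `z`
(`IsWeakPartial.integral_mul_pd`).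

Conversely, weak solutions for different `l` are orthogonal in `L²`, because the form is symmetric.
From a weak solution for `l`, subtract its projection to the finite-dimensional sum of the
`sepSpace`s with eigenvalue `l`. The remainder is orthogonal to these spaces by construction and to
the others by symmetry, hence to every separated field, and it vanishes because those fields are
complete in `H` (`MemH.eq_zero_of_dot_sepL2`, `weakSolutions_eq_iSup`). Completeness in `H` reduces
to that of scalar modes: the Fourier coefficients of a field in `H`, taken as amplitudes, satisfy
the amplitude relation themselves. Scalar completeness is Stone–Weierstrass, applied to measures
pushed forward to a cube.

Eigenfunctions are thus finite sums of fields with `-Δu = l u`, so a pressure has zero weak gradient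
and is constant. Dimensions are counted in the coefficients; the case distinctions come from sines
of frequency zero. -/

/-! ### Integration over the period cell -/

/-- The closed period cell. -/
def cell : Set Pt := Set.Icc 0 (2 * π) ×ˢ Set.Icc 0 (2 * π) ×ˢ Set.Icc (-1) 1

theorem isCompact_cell : IsCompact cell := isCompact_Icc.prod (isCompact_Icc.prod isCompact_Icc)

theorem convex_cell : Convex ℝ cell :=
  (convex_Icc _ _).prod ((convex_Icc _ _).prod (convex_Icc _ _))

theorem measurableSet_openCell :
    MeasurableSet (Set.Ioc 0 (2 * π) ×ˢ Set.Ioc 0 (2 * π) ×ˢ Set.Ioo (-1) 1 : Set Pt) :=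
  measurableSet_Ioc.prod (measurableSet_Ioc.prod measurableSet_Ioo)

theorem volΩ_eq_prod : volΩ = (volume.restrict (Set.Ioc 0 (2 * π))).prod
    ((volume.restrict (Set.Ioc 0 (2 * π))).prod (volume.restrict (Set.Ioo (-1) 1))) := by
  rw [Measure.prod_restrict, Measure.prod_restrict]; rfl

instance : IsFiniteMeasure volΩ := by rw [volΩ_eq_prod]; infer_instance

theorem ae_volΩ {P : Pt → Prop} (h : ∀ x y z : ℝ, x ∈ Set.Ioc 0 (2 * π) → y ∈ Set.Ioc 0 (2 * π) →
    z ∈ Set.Ioo (-1) 1 → P (x, y, z)) : ∀ᵐ X ∂volΩ, P X := by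
  refine (ae_restrict_iff' measurableSet_openCell).2 (Eventually.of_forall ?_)
  rintro ⟨x, y, z⟩ ⟨hx, hy, hz⟩
  exact h x y z hx hy hz

theorem ae_mem_cell : ∀ᵐ X ∂volΩ, X ∈ cell :=
  ae_volΩ fun _ _ _ hx hy hz => ⟨⟨hx.1.le, hx.2⟩, ⟨hy.1.le, hy.2⟩, ⟨hz.1.le, hz.2.le⟩⟩

theorem exists_bound_cell {f : Pt → ℝ} (hf : Continuous f) : ∃ C, ∀ X ∈ cell, ‖f X‖ ≤ C :=
  isCompact_cell.exists_bound_of_continuousOn hf.continuousOn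

theorem memLp_of_continuous {f : Pt → ℝ} (hf : Continuous f) : MemLp f 2 volΩ := by
  obtain ⟨C, hC⟩ := exists_bound_cell hf
  exact MemLp.of_bound hf.aestronglyMeasurable C (ae_mem_cell.mono hC)

theorem integrable_of_continuous {f : Pt → ℝ} (hf : Continuous f) : Integrable f volΩ :=
  (memLp_of_continuous hf).integrable (by norm_num)

theorem integrable_L2_mul (f : L2) {g : Pt → ℝ} (hg : Continuous g) :
    Integrable (fun X => f X * g X) volΩ :=
  (Lp.memLp f).integrable_mul (memLp_of_continuous hg)

/-- Continuity upgrades the almost everywhere identity on the open cell, and density extends it to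
the faces; this permits evaluation at corner points later. -/
theorem eq_zero_on_cell {f : Pt → ℝ} (hf : Continuous f) (h : f =ᵐ[volΩ] 0) :
    ∀ X ∈ cell, f X = 0 := by
  have hI : (interior cell : Set Pt) =
      Set.Ioo 0 (2 * π) ×ˢ Set.Ioo 0 (2 * π) ×ˢ Set.Ioo (-1) 1 := by
    rw [cell, interior_prod_eq, interior_prod_eq, interior_Icc, interior_Icc]
  have h1 : f =ᵐ[volume.restrict (interior cell)] 0 := by
    refine ae_restrict_of_ae_restrict_of_subset ?_ h
    rw [hI]
    exact Set.prod_mono Set.Ioo_subset_Ioc_self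
      (Set.prod_mono Set.Ioo_subset_Ioc_self subset_rfl)
  have h2 := Measure.eqOn_open_of_ae_eq h1 isOpen_interior hf.continuousOn continuousOn_const
  have h3 : cell ⊆ closure (interior cell) := by
    have h2π : (0 : ℝ) ≠ 2 * π := by positivity
    rw [hI, closure_prod_eq, closure_prod_eq, closure_Ioo h2π, closure_Ioo (by norm_num)]
    exact subset_rfl
  exact fun X hX => (h2.closure hf continuous_const) (h3 hX)

/-! ### Continuous functions as elements of `L²` -/

open Classical in
/-- The class of `f` in `L²(Ω)`, or `0` if `f` is not square integrable. -/
noncomputable def toL2 (f : Pt → ℝ) : L2 := if h : MemLp f 2 volΩ then h.toLp f else 0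

theorem coeFn_toL2 {f : Pt → ℝ} (hf : Continuous f) : toL2 f =ᵐ[volΩ] f := by
  rw [toL2, dif_pos (memLp_of_continuous hf)]
  exact MemLp.coeFn_toLp _

theorem eq_toL2 {f : Pt → ℝ} (hf : Continuous f) {u : L2} (h : u =ᵐ[volΩ] f) : u = toL2 f :=
  Lp.ext (h.trans (coeFn_toL2 hf).symm)

theorem inner_eq_integral (f g : L2) : inner ℝ f g = ∫ X, f X * g X ∂volΩ := by
  rw [L2.inner_def]
  exact integral_congr_ae (Eventually.of_forall fun X => mul_comm _ _)

theorem inner_toL2 (f : L2) {g : Pt → ℝ} (hg : Continuous g) :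
    inner ℝ f (toL2 g) = ∫ X, f X * g X ∂volΩ := by
  rw [inner_eq_integral]
  refine integral_congr_ae ?_
  filter_upwards [coeFn_toL2 hg] with X hX
  rw [hX]

theorem toL2_inner_toL2 {f g : Pt → ℝ} (hf : Continuous f) (hg : Continuous g) :
    inner ℝ (toL2 f) (toL2 g) = ∫ X, f X * g X ∂volΩ := by
  rw [inner_toL2 _ hg]
  refine integral_congr_ae ?_
  filter_upwards [coeFn_toL2 hf] with X hX
  rw [hX]

theorem toL2_add {f g : Pt → ℝ} (hf : Continuous f) (hg : Continuous g) :
    toL2 (fun X => f X + g X) = toL2 f + toL2 g := by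
  refine (eq_toL2 (hf.add hg) ?_).symm
  filter_upwards [Lp.coeFn_add (toL2 f) (toL2 g), coeFn_toL2 hf, coeFn_toL2 hg] with X h1 h2 h3
  rw [h1, Pi.add_apply, Pi.add_apply, h2, h3]

theorem toL2_const_mul (c : ℝ) {f : Pt → ℝ} (hf : Continuous f) :
    toL2 (fun X => c * f X) = c • toL2 f := by
  refine (eq_toL2 (hf.const_mul c) ?_).symm
  filter_upwards [Lp.coeFn_smul c (toL2 f), coeFn_toL2 hf] with X h1 h2
  rw [h1, Pi.smul_apply, h2, smul_eq_mul]

theorem toL2_eq_zero {f : Pt → ℝ} (hf : Continuous f) (h : toL2 f = 0) : ∀ X ∈ cell, f X = 0 := by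
  refine eq_zero_on_cell hf ?_
  have := coeFn_toL2 hf
  rw [h] at this
  exact this.symm.trans (Lp.coeFn_zero ℝ 2 volΩ)

/-! ### Partial derivatives of smooth periodic functions -/

theorem IsSmooth.continuous {f : Pt → ℝ} (hf : IsSmooth f) : Continuous f := hf.1.continuous

theorem IsSmooth.differentiable {f : Pt → ℝ} (hf : IsSmooth f) : Differentiable ℝ f :=
  hf.1.differentiable (by simp)

theorem IsSmooth.add {f g : Pt → ℝ} (hf : IsSmooth f) (hg : IsSmooth g) :
    IsSmooth fun X => f X + g X :=
  ⟨hf.1.add hg.1, fun x y z => by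
    simp only [(hf.2 x y z).1, (hf.2 x y z).2, (hg.2 x y z).1, (hg.2 x y z).2, and_self]⟩

theorem IsSmooth.mul {f g : Pt → ℝ} (hf : IsSmooth f) (hg : IsSmooth g) :
    IsSmooth fun X => f X * g X :=
  ⟨hf.1.mul hg.1, fun x y z => by
    simp only [(hf.2 x y z).1, (hf.2 x y z).2, (hg.2 x y z).1, (hg.2 x y z).2, and_self]⟩

theorem isSmooth_const (c : ℝ) : IsSmooth fun _ => c := ⟨contDiff_const, fun _ _ _ => ⟨rfl, rfl⟩⟩

theorem IsSmooth.const_mul {f : Pt → ℝ} (hf : IsSmooth f) (c : ℝ) : IsSmooth fun X => c * f X :=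
  (isSmooth_const c).mul hf

theorem IsSmooth.pd {f : Pt → ℝ} (hf : IsSmooth f) (i : Fin 3) : IsSmooth (pd i f) := by
  refine ⟨(hf.1.fderiv_right (m := ∞) (by simp)).clm_apply contDiff_const, fun x y z => ?_⟩
  have h1 : (fun X : Pt => f (X + (2 * π, 0, 0))) = f := by
    funext X; obtain ⟨x, y, z⟩ := X; simpa using (hf.2 x y z).1
  have h2 : (fun X : Pt => f (X + (0, 2 * π, 0))) = f := by
    funext X; obtain ⟨x, y, z⟩ := X; simpa using (hf.2 x y z).2
  have h3 := fderiv_comp_add_right (𝕜 := ℝ) (f := f) (x := (x, y, z)) (2 * π, 0, 0)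
  have h4 := fderiv_comp_add_right (𝕜 := ℝ) (f := f) (x := (x, y, z)) (0, 2 * π, 0)
  rw [h1] at h3
  rw [h2] at h4
  simp only [Prod.mk_add_mk, add_zero] at h3 h4
  exact ⟨by rw [StokesChannel.pd, ← h3]; rfl, by rw [StokesChannel.pd, ← h4]; rfl⟩

theorem pd_add (i : Fin 3) {f g : Pt → ℝ} (hf : IsSmooth f) (hg : IsSmooth g) :
    pd i (fun X => f X + g X) = fun X => pd i f X + pd i g X := by
  funext X
  simp only [pd]
  rw [fderiv_fun_add (hf.differentiable X) (hg.differentiable X)]; rfl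

theorem pd_mul (i : Fin 3) {f g : Pt → ℝ} (hf : IsSmooth f) (hg : IsSmooth g) :
    pd i (fun X => f X * g X) = fun X => pd i f X * g X + f X * pd i g X := by
  funext X
  simp only [pd]
  rw [fderiv_fun_mul (hf.differentiable X) (hg.differentiable X)]
  simp only [add_apply, smul_apply, smul_eq_mul]
  ring

theorem pd_const (i : Fin 3) (c : ℝ) : pd i (fun _ => c) = fun _ => 0 := by
  funext X
  simp [pd]

theorem pd_const_mul (i : Fin 3) (c : ℝ) {f : Pt → ℝ} (hf : IsSmooth f) :
    pd i (fun X => c * f X) = fun X => c * pd i f X := by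
  rw [pd_mul i (isSmooth_const c) hf, pd_const]
  simp

theorem pd_comm (i j : Fin 3) {f : Pt → ℝ} (hf : IsSmooth f) : pd i (pd j f) = pd j (pd i f) := by
  have hd : Differentiable ℝ (fderiv ℝ f) :=
    (hf.1.fderiv_right (m := ∞) (by simp)).differentiable (by simp)
  have key : ∀ (a b : Pt) (X : Pt),
      fderiv ℝ (fun Y => fderiv ℝ f Y a) X b = fderiv ℝ (fderiv ℝ f) X b a := by
    intro a b X
    rw [fderiv_clm_apply (hd X) (differentiableAt_const a)]
    simp
  funext X
  have hs : IsSymmSndFDerivAt ℝ f X := (contDiff_infty.1 hf.1 2).contDiffAt.isSymmSndFDerivAt (by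
    simp)
  exact (key _ _ X).trans ((hs _ _).trans (key _ _ X).symm)

theorem pd_eq_zero_of_eqOn {f : Pt → ℝ} {U : Set Pt} (hU : IsOpen U) (h : ∀ X ∈ U, f X = 0)
    (i : Fin 3) : ∀ X ∈ U, pd i f X = 0 := by
  intro X hX
  have : f =ᶠ[𝓝 X] fun _ => 0 := by
    filter_upwards [hU.mem_nhds hX] with Y hY using h Y hY
  rw [pd, this.fderiv_eq]
  simp

theorem IsTest.pd {f : Pt → ℝ} (hf : IsTest f) (i : Fin 3) : IsTest (pd i f) := by
  obtain ⟨h1, r, hr, h2⟩ := hf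
  refine ⟨h1.pd i, r, hr, fun x y z hz => ?_⟩
  have hU : IsOpen {X : Pt | r < |X.2.2|} :=
    isOpen_lt continuous_const (by fun_prop)
  exact pd_eq_zero_of_eqOn hU (fun X hX => h2 X.1 X.2.1 X.2.2 hX) i (x, y, z) hz

theorem IsTest.mul_left {f g : Pt → ℝ} (hf : IsTest f) (hg : IsSmooth g) :
    IsTest fun X => g X * f X := by
  obtain ⟨h1, r, hr, h2⟩ := hf
  exact ⟨hg.mul h1, r, hr, fun x y z hz => by simp only [h2 x y z hz, mul_zero]⟩

theorem IsTest.eq_zero {f : Pt → ℝ} (hf : IsTest f) {X : Pt} (hX : |X.2.2| = 1) : f X = 0 := by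
  obtain ⟨h1, r, hr, h2⟩ := hf
  exact h2 X.1 X.2.1 X.2.2 (by rw [hX]; exact hr)

theorem isTest_zero : IsTest fun _ => 0 := ⟨isSmooth_const 0, 0, by norm_num, fun _ _ _ _ => rfl⟩

/-- Functions without boundary terms in the integration by parts formula for `∂ᵢ`. -/
def NoBoundaryTerm (i : Fin 3) (f : Pt → ℝ) : Prop := i = 2 → ∀ X : Pt, |X.2.2| = 1 → f X = 0

theorem integrable_slice {f : Pt → ℝ} (hf : Continuous f) (x : ℝ) :
    Integrable (fun Y : ℝ × ℝ => f (x, Y))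
      ((volume.restrict (Set.Ioc 0 (2 * π))).prod (volume.restrict (Set.Ioo (-1) 1))) := by
  have := hf.comp (f := fun Y : ℝ × ℝ => (x, Y)) (by fun_prop)
  obtain ⟨C, hC⟩ := (isCompact_Icc.prod isCompact_Icc :
    IsCompact ((Set.Icc 0 (2 * π)) ×ˢ (Set.Icc (-1 : ℝ) 1))).exists_bound_of_continuousOn
      this.continuousOn
  refine Integrable.of_bound this.aestronglyMeasurable C ?_
  rw [Measure.prod_restrict]
  refine (ae_restrict_iff' (measurableSet_Ioc.prod measurableSet_Ioo)).2
    (Eventually.of_forall fun Y hY => hC Y ?_)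
  exact ⟨Set.Ioc_subset_Icc_self hY.1, Set.Ioo_subset_Icc_self hY.2⟩

/-- Fubini with the `i`-th variable innermost: the endpoint values cancel by periodicity in `x` and
`y`, and vanish by `hb` in `z`. -/
theorem integral_pd_eq_zero (i : Fin 3) {f : Pt → ℝ} (hf : IsSmooth f) (hb : NoBoundaryTerm i f) :
    ∫ X, pd i f X ∂volΩ = 0 := by
  have hint := integrable_of_continuous (hf.pd i).continuous
  have hpi : (0 : ℝ) ≤ 2 * π := by positivity
  have hc := (hf.pd i).continuous
  have hd : ∀ (X : ℝ → Pt) (t : ℝ), HasDerivAt X (e i) t →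
      HasDerivAt (fun s => f (X s)) (pd i f (X t)) t := fun X t h =>
    (hf.differentiable (X t)).hasFDerivAt.comp_hasDerivAt t h
  rw [volΩ_eq_prod] at hint ⊢
  fin_cases i
  · rw [integral_prod_symm _ hint]
    refine integral_eq_zero_of_ae (Eventually.of_forall fun Y => ?_)
    simp only [Pi.zero_apply]
    rw [← intervalIntegral.integral_of_le hpi,
      intervalIntegral.integral_eq_sub_of_hasDerivAt (f := fun x => f (x, Y))]
    · have := (hf.2 0 Y.1 Y.2).1
      simp only [zero_add] at this
      rw [this, sub_self]
    · intro x _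
      exact hd (fun x => (x, Y)) x ((hasDerivAt_id x).prodMk (hasDerivAt_const x Y))
    · exact (hc.comp (by fun_prop)).intervalIntegrable _ _
  · rw [integral_prod _ hint]
    refine integral_eq_zero_of_ae (Eventually.of_forall fun x => ?_)
    simp only [Pi.zero_apply]
    have hint2 := integrable_slice (hf.pd 1).continuous x
    refine (integral_prod_symm _ hint2).trans ?_
    refine integral_eq_zero_of_ae (Eventually.of_forall fun z => ?_)
    simp only [Pi.zero_apply]
    rw [← intervalIntegral.integral_of_le hpi,
      intervalIntegral.integral_eq_sub_of_hasDerivAt (f := fun y => f (x, y, z))]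
    · have := (hf.2 x 0 z).2
      simp only [zero_add] at this
      rw [this, sub_self]
    · intro y _
      exact hd (fun y => (x, y, z)) y
        ((hasDerivAt_const y x).prodMk ((hasDerivAt_id y).prodMk (hasDerivAt_const y z)))
    · exact (hc.comp (by fun_prop)).intervalIntegrable _ _
  · rw [integral_prod _ hint]
    refine integral_eq_zero_of_ae (Eventually.of_forall fun x => ?_)
    simp only [Pi.zero_apply]
    have hint2 := integrable_slice (hf.pd 2).continuous x
    refine (integral_prod _ hint2).trans ?_
    refine integral_eq_zero_of_ae (Eventually.of_forall fun y => ?_)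
    simp only [Pi.zero_apply]
    rw [← integral_Ioc_eq_integral_Ioo, ← intervalIntegral.integral_of_le (by norm_num),
      intervalIntegral.integral_eq_sub_of_hasDerivAt (f := fun z => f (x, y, z))]
    · rw [hb rfl (x, y, 1) (by simp), hb rfl (x, y, -1) (by simp), sub_self]
    · intro z _
      exact hd (fun z => (x, y, z)) z
        ((hasDerivAt_const z x).prodMk ((hasDerivAt_const z y).prodMk (hasDerivAt_id z)))
    · exact (hc.comp (by fun_prop)).intervalIntegrable _ _

theorem integral_mul_pd (i : Fin 3) {f g : Pt → ℝ} (hf : IsSmooth f) (hg : IsSmooth g)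
    (hb : NoBoundaryTerm i fun X => f X * g X) :
    ∫ X, f X * pd i g X ∂volΩ = -∫ X, pd i f X * g X ∂volΩ := by
  have h := integral_pd_eq_zero i (hf.mul hg) hb
  rw [pd_mul i hf hg, integral_add (integrable_of_continuous ((hf.pd i).mul hg).continuous)
    (integrable_of_continuous (hf.mul (hg.pd i)).continuous)] at h
  linarith

theorem isWeakPartial_toL2 (i : Fin 3) {f : Pt → ℝ} (hf : IsSmooth f) :
    IsWeakPartial i (toL2 f) (toL2 (pd i f)) := by
  intro φ hφ
  have h1 := toL2_inner_toL2 hf.continuous (hφ.1.pd i).continuous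
  have h2 := toL2_inner_toL2 (hf.pd i).continuous hφ.1.continuous
  rw [inner_toL2 _ (hφ.1.pd i).continuous] at h1
  rw [inner_toL2 _ hφ.1.continuous] at h2
  rw [h1, h2]
  refine integral_mul_pd i hf hφ.1 fun _ X hX => ?_
  simp only [hφ.eq_zero hX, mul_zero]

/-! ### Integration by parts up to the boundary -/

theorem isSmooth_vertical {f : ℝ → ℝ} (hf : ContDiff ℝ ∞ f) : IsSmooth fun X => f X.2.2 :=
  ⟨hf.comp (contDiff_snd.comp contDiff_snd), fun _ _ _ => ⟨rfl, rfl⟩⟩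

theorem pd_vertical {f : ℝ → ℝ} (hf : ContDiff ℝ ∞ f) (i : Fin 3) :
    pd i (fun X => f X.2.2) = fun X => deriv f X.2.2 * (e i).2.2 := by
  funext X
  have h1 : HasDerivAt f (deriv f X.2.2) X.2.2 := (hf.differentiable (by simp) _).hasDerivAt
  have h2 : HasFDerivAt (fun Y : Pt => Y.2.2)
      ((ContinuousLinearMap.snd ℝ ℝ ℝ).comp (ContinuousLinearMap.snd ℝ ℝ (ℝ × ℝ))) X :=
    ((ContinuousLinearMap.snd ℝ ℝ ℝ).comp (ContinuousLinearMap.snd ℝ ℝ (ℝ × ℝ))).hasFDerivAt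
  have h3 : HasFDerivAt (fun Y : Pt => f Y.2.2) _ X := h1.comp_hasFDerivAt X h2
  rw [pd, h3.fderiv]
  simp

/-- A smooth cutoff function of the interval `(-1, 1)`. -/
noncomputable def cutoff (k : ℕ) (z : ℝ) : ℝ := smoothTransition ((k + 1) * (1 - z ^ 2) - 1)

theorem contDiff_cutoff (k : ℕ) : ContDiff ℝ ∞ (cutoff k) :=
  smoothTransition.contDiff.comp (by fun_prop)

theorem deriv_smoothTransition_eq_zero {t : ℝ} (h : t < 0 ∨ 1 < t) :
    deriv smoothTransition t = 0 := by
  rcases h with h | h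
  · have : smoothTransition =ᶠ[𝓝 t] fun _ => 0 := by
      filter_upwards [Iio_mem_nhds h] with s hs using smoothTransition.zero_of_nonpos (le_of_lt hs)
    rw [this.deriv_eq, deriv_const]
  · have : smoothTransition =ᶠ[𝓝 t] fun _ => 1 := by
      filter_upwards [Ioi_mem_nhds h] with s hs using smoothTransition.one_of_one_le (le_of_lt hs)
    rw [this.deriv_eq, deriv_const]

theorem exists_bound_deriv_smoothTransition : ∃ C, 0 ≤ C ∧ ∀ t, |deriv smoothTransition t| ≤ C := by
  have hc : Continuous (deriv smoothTransition) :=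
    (smoothTransition.contDiff (n := 1)).continuous_deriv le_rfl
  obtain ⟨C, hC⟩ := (isCompact_Icc (a := (0 : ℝ)) (b := 1)).exists_bound_of_continuousOn
    hc.continuousOn
  have hC0 : 0 ≤ C := (norm_nonneg _).trans (hC 0 (by simp))
  refine ⟨C, hC0, fun t => ?_⟩
  by_cases ht : t ∈ Set.Icc (0 : ℝ) 1
  · exact hC t ht
  · rw [deriv_smoothTransition_eq_zero, abs_zero]
    · exact hC0
    · simp only [Set.mem_Icc, not_and_or, not_le] at ht
      exact ht

theorem deriv_cutoff (k : ℕ) (z : ℝ) : deriv (cutoff k) z =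
    deriv smoothTransition ((k + 1) * (1 - z ^ 2) - 1) * ((k + 1) * (-(2 * z))) := by
  have h1 : HasDerivAt (fun z : ℝ => ((k : ℝ) + 1) * (1 - z ^ 2) - 1) ((k + 1) * (-(2 * z))) z := by
    have := (((hasDerivAt_pow 2 z).const_sub 1).const_mul ((k : ℝ) + 1)).sub_const 1
    simpa using this
  have h2 : HasDerivAt smoothTransition _ ((k + 1) * (1 - z ^ 2) - 1) :=
    ((smoothTransition.contDiff (n := 1)).differentiable (by simp) _).hasDerivAt
  exact (h2.comp z h1).deriv

/-- The derivative has size of order `k`, but it lives where `(k + 1) * (1 - z ^ 2) ≤ 2`, a layer of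
thickness of order `1 / k`, so the distance to the boundary compensates uniformly in `k`. -/
theorem exists_bound_deriv_cutoff :
    ∃ C, ∀ (k : ℕ) (z : ℝ), |z| < 1 → |deriv (cutoff k) z| * (1 - |z|) ≤ C := by
  obtain ⟨C, hC0, hC⟩ := exists_bound_deriv_smoothTransition
  -- The constant 4 is the product of `2 * |z| ≤ 2` and `(k + 1) * (1 - |z|) ≤ 2`.
  refine ⟨C * 4, fun k z hz => ?_⟩
  have hk : (0 : ℝ) < k + 1 := by positivity
  have hz2 : z ^ 2 = |z| ^ 2 := (sq_abs z).symm
  have hz0 := abs_nonneg z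
  rw [deriv_cutoff]
  by_cases h : 1 < ((k : ℝ) + 1) * (1 - z ^ 2) - 1
  · rw [deriv_smoothTransition_eq_zero (Or.inr h)]
    simpa using hC0
  · have h1 : ((k : ℝ) + 1) * (1 - |z|) ≤ 2 := by
      rw [hz2] at h
      nlinarith [mul_nonneg hk.le (mul_nonneg hz0 (sub_nonneg.2 hz.le))]
    rw [abs_mul, abs_mul, abs_neg, abs_mul, abs_of_pos hk, abs_of_pos (two_pos : (0:ℝ) < 2)]
    have h2 : ((k : ℝ) + 1) * (2 * |z|) * (1 - |z|) ≤ 4 := by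
      have h0 : 0 ≤ ((k : ℝ) + 1) * (1 - |z|) := mul_nonneg hk.le (sub_nonneg.2 hz.le)
      nlinarith [mul_le_mul h1 hz.le hz0 (by norm_num)]
    have h3 : 0 ≤ ((k : ℝ) + 1) * (2 * |z|) * (1 - |z|) :=
      mul_nonneg (by positivity) (sub_nonneg.2 hz.le)
    calc _ = |deriv smoothTransition ((k + 1) * (1 - z ^ 2) - 1)| *
          (((k : ℝ) + 1) * (2 * |z|) * (1 - |z|)) := by ring
      _ ≤ C * 4 := mul_le_mul (hC _) h2 h3 hC0

theorem cutoff_le_one (k : ℕ) (z : ℝ) : |cutoff k z| ≤ 1 := by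
  rw [cutoff, abs_of_nonneg (smoothTransition.nonneg _)]
  exact smoothTransition.le_one _

theorem eventually_cutoff {z : ℝ} (hz : |z| < 1) :
    ∀ᶠ k : ℕ in atTop, cutoff k z = 1 ∧ deriv (cutoff k) z = 0 := by
  have h1 : 0 < 1 - z ^ 2 := by
    rw [← sq_abs]; nlinarith [abs_nonneg z]
  obtain ⟨N, hN⟩ := exists_nat_gt (2 / (1 - z ^ 2))
  filter_upwards [eventually_ge_atTop N] with k hk
  have hk' : (N : ℝ) ≤ k := by exact_mod_cast hk
  have h2 : 1 < ((k : ℝ) + 1) * (1 - z ^ 2) - 1 := by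
    rw [div_lt_iff₀ h1] at hN
    nlinarith
  refine ⟨smoothTransition.one_of_one_le h2.le, ?_⟩
  rw [deriv_cutoff, deriv_smoothTransition_eq_zero (Or.inr h2), zero_mul]

theorem isTest_cutoff (k : ℕ) : IsTest fun X => cutoff k X.2.2 := by
  -- The argument of `smoothTransition` changes sign at `z ^ 2 = k / (k + 1)`.
  refine ⟨isSmooth_vertical (contDiff_cutoff k), √(k / (k + 1)), ?_, fun x y z hz => ?_⟩
  · rw [Real.sqrt_lt' one_pos, one_pow, div_lt_one (by positivity)]
    linarith
  · refine smoothTransition.zero_of_nonpos ?_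
    have h1 : (k : ℝ) / (k + 1) < |z| ^ 2 := (Real.sqrt_lt' (by
      exact lt_of_le_of_lt (Real.sqrt_nonneg _) hz)).1 hz
    rw [sq_abs, div_lt_iff₀ (by positivity)] at h1
    simp only
    linarith

theorem tendsto_integral_cutoff (f : L2) {g : Pt → ℝ} (hg : Continuous g) :
    Tendsto (fun k : ℕ => ∫ X, f X * (g X * cutoff k X.2.2) ∂volΩ) atTop
      (𝓝 (∫ X, f X * g X ∂volΩ)) := by
  have hint := integrable_L2_mul f hg
  refine tendsto_integral_of_dominated_convergence (fun X => ‖f X * g X‖) (fun k => ?_) hint.norm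
    (fun k => Eventually.of_forall fun X => ?_) (ae_volΩ fun x y z _ _ hz => ?_)
  · have := (isSmooth_vertical (contDiff_cutoff k)).continuous
    exact (integrable_L2_mul f (hg.mul this)).aestronglyMeasurable
  · rw [← mul_assoc, norm_mul]
    exact mul_le_of_le_one_right (norm_nonneg _) (cutoff_le_one k _)
  · refine tendsto_const_nhds.congr' ?_
    filter_upwards [eventually_cutoff (abs_lt.2 hz)] with k hk
    rw [hk.1, mul_one]

/-- Mean value inequality along the vertical segment to the nearer boundary plane. -/
theorem exists_bound_of_eq_zero {F : Pt → ℝ} (hF : IsSmooth F)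
    (h0 : ∀ X : Pt, |X.2.2| = 1 → F X = 0) :
    ∃ C, ∀ X ∈ cell, |F X| ≤ C * (1 - |X.2.2|) := by
  have hc : Continuous (fderiv ℝ F) := hF.1.continuous_fderiv (by simp)
  obtain ⟨C, hC⟩ := isCompact_cell.exists_bound_of_continuousOn hc.continuousOn
  refine ⟨C, ?_⟩
  rintro ⟨x, y, z⟩ ⟨hx, hy, hz⟩
  have key : ∀ s : ℝ, |s| = 1 → ‖F (x, y, z) - F (x, y, s)‖ ≤ C * |z - s| := by
    intro s hs
    have hs' : s ∈ Set.Icc (-1 : ℝ) 1 := abs_le.1 hs.le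
    have := convex_cell.norm_image_sub_le_of_norm_fderiv_le (f := F)
      (fun X _ => hF.differentiable X) hC (x := (x, y, s)) (y := (x, y, z))
      ⟨hx, hy, hs'⟩ ⟨hx, hy, hz⟩
    simpa using this
  simp only at hz ⊢
  rcases le_total 0 z with h | h
  · have := key 1 (by simp)
    rw [h0 (x, y, 1) (by simp), sub_zero, abs_sub_comm, abs_of_nonneg (sub_nonneg.2 hz.2),
      Real.norm_eq_abs] at this
    rwa [abs_of_nonneg h]
  · have := key (-1) (by simp)
    rw [h0 (x, y, -1) (by simp), sub_zero, abs_of_nonneg (by linarith [hz.1]),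
      Real.norm_eq_abs] at this
    rw [abs_of_nonpos h]
    convert this using 2
    ring

/-- The linear decay of `F` at the boundary balances the growth of the cutoff's derivative, which
gives a dominating function; pointwise the derivative is eventually zero. -/
theorem tendsto_integral_deriv_cutoff (f : L2) {F : Pt → ℝ} (hF : IsSmooth F)
    (h0 : ∀ X : Pt, |X.2.2| = 1 → F X = 0) :
    Tendsto (fun k : ℕ => ∫ X, f X * (F X * deriv (cutoff k) X.2.2) ∂volΩ) atTop (𝓝 0) := by
  obtain ⟨C, hC⟩ := exists_bound_of_eq_zero hF h0
  obtain ⟨D, hD⟩ := exists_bound_deriv_cutoff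
  have hC0 : 0 ≤ C := by
    have := hC (0, 0, 0) ⟨⟨le_rfl, by positivity⟩, ⟨le_rfl, by positivity⟩, by norm_num⟩
    simp only [abs_zero, sub_zero, mul_one] at this
    exact (abs_nonneg _).trans this
  have hlim : ∫ _, (0 : ℝ) ∂volΩ = 0 := by simp
  rw [← hlim]
  refine tendsto_integral_of_dominated_convergence (fun X => ‖f X‖ * (C * D)) (fun k => ?_)
    ((((Lp.memLp f).integrable (by norm_num)).norm).mul_const _)
    (fun k => ?_) (ae_volΩ fun x y z _ _ hz => ?_)
  · have : Continuous fun X : Pt => deriv (cutoff k) X.2.2 :=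
      ((contDiff_cutoff k).continuous_deriv (by simp)).comp (by fun_prop)
    exact (integrable_L2_mul f (hF.continuous.mul this)).aestronglyMeasurable
  · refine ae_volΩ fun x y z hx hy hz => ?_
    rw [norm_mul]
    refine mul_le_mul_of_nonneg_left ?_ (norm_nonneg _)
    have hz' : |z| < 1 := abs_lt.2 hz
    have h1 := hC (x, y, z) ⟨Set.Ioc_subset_Icc_self hx, Set.Ioc_subset_Icc_self hy,
      Set.Ioo_subset_Icc_self hz⟩
    rw [Real.norm_eq_abs, abs_mul]
    calc _ ≤ C * (1 - |z|) * |deriv (cutoff k) z| :=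
          mul_le_mul_of_nonneg_right h1 (abs_nonneg _)
      _ = C * (|deriv (cutoff k) z| * (1 - |z|)) := by ring
      _ ≤ C * D := mul_le_mul_of_nonneg_left (hD k z hz') hC0
  · refine tendsto_const_nhds.congr' ?_
    filter_upwards [eventually_cutoff (abs_lt.2 hz)] with k hk
    simp only [hk.2, mul_zero]

/-- Integration by parts against functions that are smooth up to the boundary. -/
theorem IsWeakPartial.integral_mul_pd {i : Fin 3} {f g : L2} (h : IsWeakPartial i f g)
    {F : Pt → ℝ} (hF : IsSmooth F) (h0 : NoBoundaryTerm i F) :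
    ∫ X, f X * pd i F X ∂volΩ = -∫ X, g X * F X ∂volΩ := by
  have hχ : ∀ k, IsSmooth fun X : Pt => cutoff k X.2.2 := fun k => (isTest_cutoff k).1
  have hχ' : ∀ k, Continuous fun X : Pt => deriv (cutoff k) X.2.2 := fun k =>
      ((contDiff_cutoff k).continuous_deriv (by simp)).comp (by fun_prop)
  -- The weak derivative is tested with `F` times the cutoff; the Leibniz rule adds the term in
  -- which the cutoff is differentiated, nonzero only for `i = 2`.
  have h1 : ∀ k : ℕ, ∫ X, f X * (pd i F X * cutoff k X.2.2) ∂volΩ +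
      ∫ X, f X * (F X * (deriv (cutoff k) X.2.2 * (e i).2.2)) ∂volΩ =
        -∫ X, g X * (F X * cutoff k X.2.2) ∂volΩ := by
    intro k
    have hi1 := integrable_L2_mul f ((hF.pd i).mul (hχ k)).continuous
    have hi2 : Integrable (fun X => f X * (F X * (deriv (cutoff k) X.2.2 * (e i).2.2))) volΩ :=
      integrable_L2_mul f (hF.continuous.mul ((hχ' k).mul continuous_const))
    rw [← h _ ((isTest_cutoff k).mul_left hF), pd_mul i hF (hχ k), pd_vertical (contDiff_cutoff k),
      ← integral_add hi1 hi2]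
    simp only [mul_add]
  have h2 : Tendsto (fun k : ℕ => ∫ X, f X * (F X * (deriv (cutoff k) X.2.2 * (e i).2.2)) ∂volΩ)
      atTop (𝓝 0) := by
    by_cases hi : i = 2
    · subst hi
      have : (e 2).2.2 = 1 := rfl
      simp only [this, mul_one]
      exact tendsto_integral_deriv_cutoff f hF (h0 rfl)
    · have : (e i).2.2 = 0 := by
        fin_cases i
        · rfl
        · rfl
        · exact absurd rfl hi
      simp [this]
  have h3 := (tendsto_integral_cutoff f (hF.pd i).continuous).add h2
  rw [add_zero] at h3
  exact tendsto_nhds_unique (h3.congr h1) (tendsto_integral_cutoff g hF.continuous).neg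

theorem noBoundaryTerm_of_ne {i : Fin 3} (hi : i ≠ 2) (F : Pt → ℝ) : NoBoundaryTerm i F :=
  fun h => absurd h hi

/-- A weakly divergence free gradient has zero trace, tested with smooth functions. -/
theorem MemV.integral_trace {φ : L2Field} (hφ : MemV φ) {Φ : Fin 3 → Fin 3 → L2}
    (hΦ : IsWeakGrad φ Φ) {S : Pt → ℝ} (hS : IsSmooth S) :
    ∑ i, ∫ X, Φ i i X * S X ∂volΩ = 0 := by
  have h1 : ∀ k : ℕ, ∑ i, ∫ X, Φ i i X * (S X * cutoff k X.2.2) ∂volΩ = 0 := by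
    intro k
    have hT := (isTest_cutoff k).mul_left hS
    have h2 := hφ.1.1 _ hT
    rw [Finset.sum_congr rfl fun i _ => hΦ i i _ hT, Finset.sum_neg_distrib, neg_eq_zero] at h2
    exact h2
  have h3 : Tendsto (fun k : ℕ => ∑ i, ∫ X, Φ i i X * (S X * cutoff k X.2.2) ∂volΩ) atTop
      (𝓝 (∑ i, ∫ X, Φ i i X * S X ∂volΩ)) :=
    tendsto_finsetSum _ fun i _ => tendsto_integral_cutoff _ hS.continuous
  simp only [h1] at h3
  exact tendsto_nhds_unique h3 tendsto_const_nhds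

/-- For fields in `V` the integration by parts of `∂₃ φ₃` has no boundary term. -/
theorem MemV.integral_mul_pd_normal {φ : L2Field} (hφ : MemV φ) {Φ : Fin 3 → Fin 3 → L2}
    (hΦ : IsWeakGrad φ Φ) {S : Pt → ℝ} (hS : IsSmooth S) :
    ∫ X, φ 2 X * pd 2 S X ∂volΩ = -∫ X, Φ 2 2 X * S X ∂volΩ := by
  -- `S` need not vanish on `Γ`. The sums over `i` of `∫ Φ i i * S` and of `∫ φ i * pd i S` both
  -- vanish, and the horizontal terms cancel in pairs, which leaves the vertical identity.
  have h1 := hφ.integral_trace hΦ hS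
  have h2 := hφ.1.2 S hS
  have h3 := (hΦ 0 0).integral_mul_pd hS (noBoundaryTerm_of_ne (by decide) S)
  have h4 := (hΦ 1 1).integral_mul_pd hS (noBoundaryTerm_of_ne (by decide) S)
  rw [Fin.sum_univ_three] at h1 h2
  linarith

/-! ### Classical solutions are weak solutions -/

theorem isSmooth_lap {f : Pt → ℝ} (hf : IsSmooth f) : IsSmooth (lap f) := by
  have : lap f = fun X => pd 0 (pd 0 f) X + pd 1 (pd 1 f) X + pd 2 (pd 2 f) X := by
    funext X
    rw [lap, Fin.sum_univ_three]
  rw [this]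
  exact (((hf.pd 0).pd 0).add ((hf.pd 1).pd 1)).add ((hf.pd 2).pd 2)

theorem integral_mul_lap {f φ : Pt → ℝ} (hf : IsSmooth f) (hφ : IsTest φ) :
    ∫ X, f X * lap φ X ∂volΩ = ∫ X, lap f X * φ X ∂volΩ := by
  have key : ∀ j, ∫ X, f X * pd j (pd j φ) X ∂volΩ = ∫ X, pd j (pd j f) X * φ X ∂volΩ := by
    intro j
    rw [integral_mul_pd j hf (hφ.1.pd j) fun _ X hX => by
        simp only [(hφ.pd j).eq_zero hX, mul_zero],
      integral_mul_pd j (hf.pd j) hφ.1 fun _ X hX => by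
        simp only [hφ.eq_zero hX, mul_zero], neg_neg]
  simp only [lap, Finset.mul_sum, Finset.sum_mul]
  rw [integral_finsetSum _ fun j _ =>
      integrable_of_continuous (hf.mul ((hφ.1.pd j).pd j)).continuous,
    integral_finsetSum _ fun j _ =>
      integrable_of_continuous (((hf.pd j).pd j).mul hφ.1).continuous]
  exact Finset.sum_congr rfl fun j _ => key j

variable {l : ℝ} {u : Fin 3 → Pt → ℝ}

theorem IsClassicalSolution.memV {q : Pt → ℝ} (h : IsClassicalSolution 0 l u q) :
    MemV fun i => toL2 (u i) := by
  have hs := h.smooth_u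
  have key : HasZeroNormalTrace fun i => toL2 (u i) := by
    intro ψ hψ
    have h1 : ∀ i, ∫ X, toL2 (u i) X * pd i ψ X ∂volΩ = -∫ X, pd i (u i) X * ψ X ∂volΩ := by
      intro i
      rw [← inner_toL2 _ (hψ.pd i).continuous, toL2_inner_toL2 (hs i).continuous
        (hψ.pd i).continuous]
      refine integral_mul_pd i (hs i) hψ ?_
      rintro rfl X hX
      have h2 := h.normal X hX
      have hz : X.2.2 ≠ 0 := by
        intro h0; rw [h0] at hX; simp at hX
      simp only [Fin.sum_univ_three, nu, Matrix.cons_val_zero, Matrix.cons_val_one,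
        Matrix.cons_val_two, Matrix.tail_cons, Matrix.head_cons, mul_zero, zero_add] at h2
      have h3 : u 2 X = 0 := (mul_eq_zero.1 h2).resolve_right hz
      simp only [h3, zero_mul]
    rw [Finset.sum_congr rfl fun i _ => h1 i, Finset.sum_neg_distrib, neg_eq_zero,
      ← integral_finsetSum _ fun i _ =>
        integrable_of_continuous (((hs i).pd i).mul hψ).continuous]
    refine integral_eq_zero_of_ae (ae_volΩ fun x y z _ _ hz => ?_)
    simp only [Pi.zero_apply]
    rw [← Finset.sum_mul, h.divergence (x, y, z) (abs_lt.2 hz), zero_mul]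
  exact ⟨⟨fun ψ hψ => key ψ hψ.1, key⟩, fun i j => toL2 (pd j (u i)),
    fun i j => isWeakPartial_toL2 j (hs i)⟩

/-- Contraction with the symmetric tensor `G + Gᵀ` ignores the antisymmetric part of `Φ`. -/
theorem two_mul_sum_strain (G Φ : Fin 3 → Fin 3 → L2) :
    2 * ∑ i, ∑ j, inner ℝ (strain G i j) (strain Φ i j) =
      ∑ i, ∑ j, inner ℝ (Φ i j) (G i j + G j i) := by
  simp only [strain, Fin.sum_univ_three, inner_smul_left, inner_smul_right, inner_add_left,
    inner_add_right, RCLike.conj_to_real]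
  simp only [real_inner_comm (G _ _) (Φ _ _)]
  ring

/-- Let `S = ∇u + ∇uᵀ`. In the integration by parts of `S : ∇φ`, horizontal derivatives give no
boundary term, the entries `S i 2` with `i ≠ 2` vanish on `Γ` by the tangential condition, and the
entry `S 2 2` is covered by the zero normal trace of `φ`. Inside, the divergence of `S` is `Δu + ∇(∇
· u) = -l u`. -/
theorem IsClassicalSolution.isWeakSolution {Q : ℝ}
    (h : IsClassicalSolution 0 l u fun _ => Q) : IsWeakSolution l fun i => toL2 (u i) := by
  have hs := h.smooth_u
  refine ⟨h.memV, fun i j => toL2 (pd j (u i)), fun i j => isWeakPartial_toL2 j (hs i),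
    fun φ hφ Φ hΦ => ?_⟩
  simp only [← inner_eq_integral]
  rw [two_mul_sum_strain]
  let S : Fin 3 → Fin 3 → Pt → ℝ := fun i j X => pd j (u i) X + pd i (u j) X
  have hS : ∀ i j, IsSmooth (S i j) := fun i j => ((hs i).pd j).add ((hs j).pd i)
  have h1 : ∀ i j, inner ℝ (Φ i j) (toL2 (pd j (u i)) + toL2 (pd i (u j))) =
      -∫ X, φ i X * pd j (S i j) X ∂volΩ := by
    intro i j
    rw [← toL2_add ((hs i).pd j).continuous ((hs j).pd i).continuous,
      inner_toL2 _ (hS i j).continuous, eq_neg_iff_add_eq_zero, add_comm, ← eq_neg_iff_add_eq_zero]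
    by_cases hj : j = 2
    · by_cases hi : i = 2
      · subst hi hj
        exact hφ.integral_mul_pd_normal hΦ (hS 2 2)
      · subst hj
        refine (hΦ i 2).integral_mul_pd (hS i 2) fun _ X hX => ?_
        have h2 := h.tangential X hX i hi
        have hz : X.2.2 ≠ 0 := by
          intro h0; rw [h0] at hX; simp at hX
        simp only [Fin.sum_univ_three, nu, Matrix.cons_val_zero, Matrix.cons_val_one,
          Matrix.cons_val_two, Matrix.tail_cons, Matrix.head_cons, mul_zero, zero_add,
          zero_mul, add_zero] at h2
        have h3 : (pd 2 (u i) X + pd i (u 2) X) * X.2.2 = 0 := by linarith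
        exact (mul_eq_zero.1 h3).resolve_right hz
    · exact (hΦ i j).integral_mul_pd (hS i j) (noBoundaryTerm_of_ne hj _)
  rw [Finset.mul_sum]
  refine Finset.sum_congr rfl fun i _ => ?_
  rw [Finset.sum_congr rfl fun j _ => h1 i j, Finset.sum_neg_distrib,
    ← integral_finsetSum _ fun j _ => integrable_L2_mul _ ((hS i j).pd j).continuous,
    real_inner_comm, inner_toL2 _ (hs i).continuous, ← integral_const_mul, ← integral_neg]
  refine integral_congr_ae (ae_volΩ fun x y z _ _ hz => ?_)
  have hX : |((x, y, z) : Pt).2.2| < 1 := abs_lt.2 hz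
  have hU : IsOpen {X : Pt | |X.2.2| < 1} := isOpen_lt (by fun_prop) continuous_const
  -- The divergence is known to vanish only in the open slab, which suffices to differentiate it
  -- there.
  have hdiv : pd i (fun X => pd 0 (u 0) X + pd 1 (u 1) X + pd 2 (u 2) X) (x, y, z) = 0 := by
    refine pd_eq_zero_of_eqOn hU (fun X hX => ?_) i _ hX
    have := h.divergence X hX
    rwa [Fin.sum_univ_three] at this
  rw [pd_add i (((hs 0).pd 0).add ((hs 1).pd 1)) ((hs 2).pd 2),
    pd_add i ((hs 0).pd 0) ((hs 1).pd 1)] at hdiv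
  have hmom := h.momentum (x, y, z) hX i
  rw [pd_const, lap, Fin.sum_univ_three] at hmom
  have hexp : ∀ j, pd j (S i j) (x, y, z) =
      pd j (pd j (u i)) (x, y, z) + pd i (pd j (u j)) (x, y, z) := by
    intro j
    rw [show S i j = fun X => pd j (u i) X + pd i (u j) X from rfl,
      pd_add j ((hs i).pd j) ((hs j).pd i), pd_comm j i (hs j)]
  simp only [← Finset.mul_sum, Fin.sum_univ_three, hexp]
  linear_combination (-(φ i (x, y, z))) * hdiv + φ i (x, y, z) * hmom

/-- The distributional equation `-Δu = l u` in `Ω`. -/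
def IsVeryWeakSolution (l : ℝ) (u : L2Field) : Prop :=
  ∀ φ : Fin 3 → Pt → ℝ, (∀ i, IsTest (φ i)) →
    -(∑ i, ∫ X, u i X * lap (φ i) X ∂volΩ) = l * ∑ i, ∫ X, u i X * φ i X ∂volΩ

theorem IsClassicalSolution.isVeryWeakSolution {Q : ℝ}
    (h : IsClassicalSolution 0 l u fun _ => Q) : IsVeryWeakSolution l fun i => toL2 (u i) := by
  intro φ hφ
  rw [← Finset.sum_neg_distrib, Finset.mul_sum]
  refine Finset.sum_congr rfl fun i _ => ?_
  have hs := h.smooth_u i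
  rw [← inner_toL2 _ (isSmooth_lap (hφ i).1).continuous, ← inner_toL2 _ (hφ i).1.continuous,
    toL2_inner_toL2 hs.continuous (isSmooth_lap (hφ i).1).continuous,
    toL2_inner_toL2 hs.continuous (hφ i).1.continuous, integral_mul_lap hs (hφ i),
    ← integral_neg, ← integral_const_mul]
  refine integral_congr_ae (ae_volΩ fun x y z _ _ hz => ?_)
  have hmom := h.momentum (x, y, z) (abs_lt.2 hz) i
  rw [pd_const] at hmom
  simp only
  linear_combination φ i (x, y, z) * hmom

/-! ### Linearity -/

theorem integral_add_L2 (f g : L2) {ψ : Pt → ℝ} (hψ : Continuous ψ) :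
    ∫ X, (f + g) X * ψ X ∂volΩ = ∫ X, f X * ψ X ∂volΩ + ∫ X, g X * ψ X ∂volΩ := by
  simp only [← inner_toL2 _ hψ, inner_add_left]

theorem integral_smul_L2 (c : ℝ) (f : L2) {ψ : Pt → ℝ} (hψ : Continuous ψ) :
    ∫ X, (c • f) X * ψ X ∂volΩ = c * ∫ X, f X * ψ X ∂volΩ := by
  simp only [← inner_toL2 _ hψ, inner_smul_left, RCLike.conj_to_real]

theorem integral_zero_L2 {ψ : Pt → ℝ} (hψ : Continuous ψ) :
    ∫ X, (0 : L2) X * ψ X ∂volΩ = 0 := by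
  rw [← inner_toL2 _ hψ, inner_zero_left]

theorem IsWeakPartial.add {i : Fin 3} {f g f' g' : L2} (h : IsWeakPartial i f g)
    (h' : IsWeakPartial i f' g') : IsWeakPartial i (f + f') (g + g') := by
  intro φ hφ
  rw [integral_add_L2 _ _ (hφ.1.pd i).continuous, integral_add_L2 _ _ hφ.1.continuous, h φ hφ,
    h' φ hφ, neg_add]

theorem IsWeakPartial.smul {i : Fin 3} {f g : L2} (c : ℝ) (h : IsWeakPartial i f g) :
    IsWeakPartial i (c • f) (c • g) := by
  intro φ hφ
  rw [integral_smul_L2 _ _ (hφ.1.pd i).continuous, integral_smul_L2 _ _ hφ.1.continuous, h φ hφ,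
    mul_neg]

theorem isWeakPartial_zero (i : Fin 3) : IsWeakPartial i 0 0 := by
  intro φ hφ
  rw [integral_zero_L2 (hφ.1.pd i).continuous, integral_zero_L2 hφ.1.continuous, neg_zero]

theorem sum_integral_add (u v : L2Field) {ψ : Fin 3 → Pt → ℝ} (hψ : ∀ i, Continuous (ψ i)) :
    ∑ i, ∫ X, (u + v) i X * ψ i X ∂volΩ =
      ∑ i, ∫ X, u i X * ψ i X ∂volΩ + ∑ i, ∫ X, v i X * ψ i X ∂volΩ := by
  simp only [Pi.add_apply, integral_add_L2 _ _ (hψ _), Finset.sum_add_distrib]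

theorem sum_integral_smul (c : ℝ) (u : L2Field) {ψ : Fin 3 → Pt → ℝ}
    (hψ : ∀ i, Continuous (ψ i)) :
    ∑ i, ∫ X, (c • u) i X * ψ i X ∂volΩ = c * ∑ i, ∫ X, u i X * ψ i X ∂volΩ := by
  simp only [Pi.smul_apply, integral_smul_L2 _ _ (hψ _), Finset.mul_sum]

theorem sum_integral_zero {ψ : Fin 3 → Pt → ℝ} (hψ : ∀ i, Continuous (ψ i)) :
    ∑ i, ∫ X, (0 : L2Field) i X * ψ i X ∂volΩ = 0 := by
  simp only [Pi.zero_apply, integral_zero_L2 (hψ _), Finset.sum_const_zero]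

theorem MemH.add {u v : L2Field} (hu : MemH u) (hv : MemH v) : MemH (u + v) := by
  refine ⟨fun ψ hψ => ?_, fun ψ hψ => ?_⟩
  · rw [sum_integral_add u v fun i => (hψ.1.pd i).continuous, hu.1 ψ hψ, hv.1 ψ hψ, add_zero]
  · rw [sum_integral_add u v fun i => (hψ.pd i).continuous, hu.2 ψ hψ, hv.2 ψ hψ, add_zero]

theorem MemH.smul (c : ℝ) {u : L2Field} (hu : MemH u) : MemH (c • u) := by
  refine ⟨fun ψ hψ => ?_, fun ψ hψ => ?_⟩
  · rw [sum_integral_smul c u fun i => (hψ.1.pd i).continuous, hu.1 ψ hψ, mul_zero]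
  · rw [sum_integral_smul c u fun i => (hψ.pd i).continuous, hu.2 ψ hψ, mul_zero]

theorem memH_zero : MemH 0 :=
  ⟨fun _ hψ => sum_integral_zero fun i => (hψ.1.pd i).continuous,
    fun _ hψ => sum_integral_zero fun i => (hψ.pd i).continuous⟩

/-- The weak solutions form a subspace. -/
noncomputable def weakSolutions (l : ℝ) : Submodule ℝ L2Field where
  carrier := {u | IsWeakSolution l u}
  add_mem' := by
    rintro u v ⟨hu, G, hG, hGu⟩ ⟨hv, K, hK, hKv⟩
    have hs : IsWeakGrad (u + v) (G + K) := fun i j => (hG i j).add (hK i j)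
    refine ⟨⟨hu.1.add hv.1, _, hs⟩, _, hs, fun φ hφ Φ hΦ => ?_⟩
    have h1 := hGu φ hφ Φ hΦ
    have h2 := hKv φ hφ Φ hΦ
    simp only [← inner_eq_integral, two_mul_sum_strain] at h1 h2 ⊢
    simp only [Pi.add_apply, inner_add_left, inner_add_right, Finset.sum_add_distrib, mul_add]
      at h1 h2 ⊢
    linarith
  zero_mem' := by
    have hs : IsWeakGrad 0 0 := fun i j => isWeakPartial_zero j
    refine ⟨⟨memH_zero, _, hs⟩, _, hs, fun φ hφ Φ hΦ => ?_⟩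
    simp only [← inner_eq_integral, two_mul_sum_strain]
    simp
  smul_mem' := by
    rintro c u ⟨hu, G, hG, hGu⟩
    have hs : IsWeakGrad (c • u) (c • G) := fun i j => (hG i j).smul c
    refine ⟨⟨hu.1.smul c, _, hs⟩, _, hs, fun φ hφ Φ hΦ => ?_⟩
    have h1 := hGu φ hφ Φ hΦ
    simp only [← inner_eq_integral, two_mul_sum_strain] at h1 ⊢
    simp only [Pi.smul_apply, ← smul_add, inner_smul_left, inner_smul_right, RCLike.conj_to_real,
      ← Finset.mul_sum]
    rw [h1]
    ring

/-- The distributional solutions of `-Δu = l u` form a subspace. -/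
def veryWeakSolutions (l : ℝ) : Submodule ℝ L2Field where
  carrier := {u | IsVeryWeakSolution l u}
  add_mem' := by
    intro u v hu hv φ hφ
    rw [sum_integral_add u v fun i => (isSmooth_lap (hφ i).1).continuous,
      sum_integral_add u v fun i => (hφ i).1.continuous, neg_add, hu φ hφ, hv φ hφ, mul_add]
  zero_mem' := by
    intro φ hφ
    rw [sum_integral_zero fun i => (isSmooth_lap (hφ i).1).continuous,
      sum_integral_zero fun i => (hφ i).1.continuous, neg_zero, mul_zero]
  smul_mem' := by
    intro c u hu φ hφ
    rw [sum_integral_smul c u fun i => (isSmooth_lap (hφ i).1).continuous,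
      sum_integral_smul c u fun i => (hφ i).1.continuous, ← mul_neg, hu φ hφ]
    ring

/-- Weak solutions for different parameters are orthogonal. -/
theorem IsWeakSolution.inner_eq {l l' : ℝ} {u w : L2Field} (hu : IsWeakSolution l u)
    (hw : IsWeakSolution l' w) : (l - l') * ∑ i, inner ℝ (u i) (w i) = 0 := by
  obtain ⟨hu', G, hG, hGu⟩ := hu
  obtain ⟨hw', K, hK, hKw⟩ := hw
  -- Each solution serves as test field for the other; the left-hand sides agree by symmetry.
  have h1 := hGu w hw' K hK
  have h2 := hKw u hu' G hG
  simp only [← inner_eq_integral] at h1 h2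
  simp only [real_inner_comm (strain G _ _) (strain K _ _), real_inner_comm (u _) (w _)] at h2
  rw [sub_mul, ← h1, ← h2, sub_self]

/-! ### Trigonometric modes -/

/-- The function `f(z) 𝒫_{m,n}(x, y)`. -/
noncomputable def mode (m n : ℕ) (f : ℝ → ℝ) (a b c d : ℝ) : Pt → ℝ :=
  fun X => f X.2.2 * Pw m n a b c d X.1 X.2.1

/-- The first two horizontal factors are `Pw` with signed, permuted coefficients, because `m * Pu`
and `n * Pv` are the `x`- and `y`-derivatives of `Pw`. One type of mode thus serves all components.
-/
theorem Pu_eq_Pw (m n : ℕ) (a b c d x y : ℝ) : Pu m n a b c d x y = Pw m n (-b) a d (-c) x y := by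
  simp only [Pu, Pw]; ring

theorem Pv_eq_Pw (m n : ℕ) (a b c d x y : ℝ) : Pv m n a b c d x y = Pw m n (-d) (-c) b a x y := by
  simp only [Pv, Pw]; ring

theorem isSmooth_mode (m n : ℕ) {f : ℝ → ℝ} (hf : ContDiff ℝ ∞ f) (a b c d : ℝ) :
    IsSmooth (mode m n f a b c d) := by
  refine (isSmooth_vertical hf).mul ⟨?_, fun x y z => ?_⟩
  · unfold Pw
    fun_prop
  · simp only [Pw, mul_add, cos_add_nat_mul_two_pi, sin_add_nat_mul_two_pi, and_self]

theorem pd_zero_eq {F : Pt → ℝ} (hF : IsSmooth F) {x y z c : ℝ}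
    (h : HasDerivAt (fun t => F (t, y, z)) c x) : pd 0 F (x, y, z) = c :=
  ((hF.differentiable (x, y, z)).hasFDerivAt.comp_hasDerivAt x
    ((hasDerivAt_id x).prodMk (hasDerivAt_const x (y, z)))).unique h

theorem pd_one_eq {F : Pt → ℝ} (hF : IsSmooth F) {x y z c : ℝ}
    (h : HasDerivAt (fun t => F (x, t, z)) c y) : pd 1 F (x, y, z) = c :=
  ((hF.differentiable (x, y, z)).hasFDerivAt.comp_hasDerivAt y
    ((hasDerivAt_const y x).prodMk ((hasDerivAt_id y).prodMk (hasDerivAt_const y z)))).unique h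

theorem pd_two_eq {F : Pt → ℝ} (hF : IsSmooth F) {x y z c : ℝ}
    (h : HasDerivAt (fun t => F (x, y, t)) c z) : pd 2 F (x, y, z) = c :=
  ((hF.differentiable (x, y, z)).hasFDerivAt.comp_hasDerivAt z
    ((hasDerivAt_const z x).prodMk ((hasDerivAt_const z y).prodMk (hasDerivAt_id z)))).unique h

theorem hasDerivAt_cos_mul (k t : ℝ) : HasDerivAt (fun s => cos (k * s)) (-(k * sin (k * t))) t := by
  have := ((hasDerivAt_id t).const_mul k).cos
  simpa [mul_comm] using this

theorem hasDerivAt_sin_mul (k t : ℝ) : HasDerivAt (fun s => sin (k * s)) (k * cos (k * t)) t := by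
  have := ((hasDerivAt_id t).const_mul k).sin
  simpa [mul_comm] using this

theorem pd_zero_mode (m n : ℕ) {f : ℝ → ℝ} (hf : ContDiff ℝ ∞ f) (a b c d : ℝ) :
    pd 0 (mode m n f a b c d) = fun X => m * mode m n f (-b) a d (-c) X := by
  funext X
  obtain ⟨x, y, z⟩ := X
  refine pd_zero_eq (isSmooth_mode m n hf a b c d) ?_
  have hc := hasDerivAt_cos_mul m x
  have hs := hasDerivAt_sin_mul m x
  have := ((((((hs.const_mul a).mul_const (sin (n * y))).add
    ((hc.const_mul b).mul_const (sin (n * y)))).add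
    ((hc.const_mul c).mul_const (cos (n * y)))).add
    ((hs.const_mul d).mul_const (cos (n * y)))).const_mul (f z))
  refine this.congr_deriv ?_
  simp only [mode, Pw]
  ring

theorem pd_one_mode (m n : ℕ) {f : ℝ → ℝ} (hf : ContDiff ℝ ∞ f) (a b c d : ℝ) :
    pd 1 (mode m n f a b c d) = fun X => n * mode m n f (-d) (-c) b a X := by
  funext X
  obtain ⟨x, y, z⟩ := X
  refine pd_one_eq (isSmooth_mode m n hf a b c d) ?_
  have hc := hasDerivAt_cos_mul n y
  have hs := hasDerivAt_sin_mul n y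
  have := (((((hs.const_mul (a * sin (m * x))).add
    (hs.const_mul (b * cos (m * x)))).add
    (hc.const_mul (c * cos (m * x)))).add
    (hc.const_mul (d * sin (m * x)))).const_mul (f z))
  refine this.congr_deriv ?_
  simp only [mode, Pw]
  ring

theorem pd_two_mode (m n : ℕ) {f g : ℝ → ℝ} (hf : ContDiff ℝ ∞ f) (k : ℝ)
    (h : ∀ z, HasDerivAt f (k * g z) z) (a b c d : ℝ) :
    pd 2 (mode m n f a b c d) = fun X => k * mode m n g a b c d X := by
  funext X
  obtain ⟨x, y, z⟩ := X
  refine pd_two_eq (isSmooth_mode m n hf a b c d) ?_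
  refine ((h z).mul_const (Pw m n a b c d x y)).congr_deriv ?_
  simp only [mode]
  ring

/-- The factor `± π p / 2` in the relation between the amplitudes. -/
noncomputable def vfreq (p : ℕ) : ℝ := (if Even p then 1 else -1) * (π / 2 * p)

theorem vfreq_sq (p : ℕ) : vfreq p ^ 2 = π ^ 2 / 4 * (p : ℝ) ^ 2 := by
  unfold vfreq
  split_ifs <;> ring

theorem vfreq_eq_zero {p : ℕ} : vfreq p = 0 ↔ p = 0 := by
  unfold vfreq
  have : π ≠ 0 := pi_ne_zero
  split_ifs <;> simp [this]

theorem contDiff_hProfile (p : ℕ) : ContDiff ℝ ∞ (hProfile p) := by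
  unfold hProfile
  split_ifs <;> fun_prop

theorem contDiff_vProfile (p : ℕ) : ContDiff ℝ ∞ (vProfile p) := by
  unfold vProfile
  split_ifs <;> fun_prop

theorem hasDerivAt_hProfile (p : ℕ) (z : ℝ) :
    HasDerivAt (hProfile p) (-vfreq p * vProfile p z) z := by
  unfold hProfile vProfile vfreq
  split_ifs
  · exact (hasDerivAt_cos_mul _ z).congr_deriv (by ring)
  · exact (hasDerivAt_sin_mul _ z).congr_deriv (by ring)

theorem hasDerivAt_vProfile (p : ℕ) (z : ℝ) :
    HasDerivAt (vProfile p) (vfreq p * hProfile p z) z := by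
  unfold hProfile vProfile vfreq
  split_ifs
  · exact (hasDerivAt_sin_mul _ z).congr_deriv (by ring)
  · exact (hasDerivAt_cos_mul _ z).congr_deriv (by ring)

/-- The parity rule is made for this: at `z = 1` the value is `sin (k π)` for `p = 2k` and `cos (k π
+ π / 2)` for `p = 2k + 1`. -/
theorem vProfile_eq_zero (p : ℕ) {z : ℝ} (hz : |z| = 1) : vProfile p z = 0 := by
  have h1 : vProfile p 1 = 0 := by
    unfold vProfile
    split_ifs with h
    · obtain ⟨k, rfl⟩ := h
      rw [show π / 2 * ((k + k : ℕ) : ℝ) * 1 = k * π by push_cast; ring]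
      exact sin_nat_mul_pi k
    · obtain ⟨k, rfl⟩ := Nat.not_even_iff_odd.1 h
      rw [cos_eq_zero_iff]
      exact ⟨k, by push_cast; ring⟩
  rcases eq_or_eq_neg_of_abs_eq hz with rfl | rfl
  · exact h1
  · unfold vProfile at h1 ⊢
    split_ifs at h1 ⊢
    · rw [mul_neg, sin_neg, h1, neg_zero]
    · rw [mul_neg, cos_neg, h1]

/-- The components of the separated fields with unit amplitudes. -/
noncomputable def basicField (m n p : ℕ) (a b c d : ℝ) : Fin 3 → Pt → ℝ :=
  ![mode m n (hProfile p) (-b) a d (-c), mode m n (hProfile p) (-d) (-c) b a,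
    mode m n (vProfile p) a b c d]

/-- The amplitudes of the gradient of a mode. -/
noncomputable def gradAmp (m n p : ℕ) : Fin 3 → ℝ := ![m, n, -vfreq p]

theorem isSmooth_basicField (m n p : ℕ) (a b c d : ℝ) (i : Fin 3) :
    IsSmooth (basicField m n p a b c d i) := by
  fin_cases i
  · exact isSmooth_mode m n (contDiff_hProfile p) _ _ _ _
  · exact isSmooth_mode m n (contDiff_hProfile p) _ _ _ _
  · exact isSmooth_mode m n (contDiff_vProfile p) _ _ _ _

theorem isSmooth_hMode (m n p : ℕ) (a b c d : ℝ) : IsSmooth (mode m n (hProfile p) a b c d) :=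
  isSmooth_mode m n (contDiff_hProfile p) _ _ _ _

theorem sepField_eq (m n p : ℕ) (a b c d U V W : ℝ) (i : Fin 3) :
    sepField m n p a b c d U V W i =
      fun X => (![U, V, W] : Fin 3 → ℝ) i * basicField m n p a b c d i X := by
  funext X
  fin_cases i
  · simp [sepField, basicField, mode, Pu_eq_Pw, mul_assoc]
  · simp [sepField, basicField, mode, Pv_eq_Pw, mul_assoc]
  · simp [sepField, basicField, mode, mul_assoc]

theorem amplitudeRel_iff (m n p : ℕ) (U V W : ℝ) :
    AmplitudeRel m n p U V W ↔ ∑ i, gradAmp m n p i * (![U, V, W] : Fin 3 → ℝ) i = 0 := by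
  simp only [AmplitudeRel, gradAmp, Fin.sum_univ_three, vfreq, Matrix.cons_val_zero,
    Matrix.cons_val_one, Matrix.cons_val_two, Matrix.tail_cons, Matrix.head_cons]
  constructor <;> intro h <;> linarith

/-- The gradient of a horizontal mode is the basic field with amplitudes `gradAmp`. Testing the zero
normal trace with such a mode therefore yields the amplitude relation for Fourier coefficients. -/
theorem pd_hMode (m n p : ℕ) (a b c d : ℝ) (i : Fin 3) :
    pd i (mode m n (hProfile p) a b c d) =
      fun X => gradAmp m n p i * basicField m n p a b c d i X := by
  fin_cases i
  · exact pd_zero_mode m n (contDiff_hProfile p) a b c d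
  · exact pd_one_mode m n (contDiff_hProfile p) a b c d
  · exact pd_two_mode m n (contDiff_hProfile p) _ (hasDerivAt_hProfile p) a b c d

/-- All three diagonal derivatives are multiples of one scalar mode, so the divergence of a
separated field is that mode times minus the defect in the amplitude relation. -/
theorem pd_basicField (m n p : ℕ) (a b c d : ℝ) (i : Fin 3) :
    pd i (basicField m n p a b c d i) =
      fun X => -gradAmp m n p i * mode m n (hProfile p) a b c d X := by
  fin_cases i
  · refine (pd_zero_mode m n (contDiff_hProfile p) _ _ _ _).trans ?_
    funext X
    simp only [gradAmp, mode, Pw, Fin.zero_eta, Matrix.cons_val_zero]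
    ring
  · refine (pd_one_mode m n (contDiff_hProfile p) _ _ _ _).trans ?_
    funext X
    simp only [gradAmp, mode, Pw, Fin.mk_one, Matrix.cons_val_one, Matrix.cons_val_zero]
    ring
  · refine (pd_two_mode m n (contDiff_vProfile p) _ (hasDerivAt_vProfile p) a b c d).trans ?_
    funext X
    simp [gradAmp]

theorem pd_pd_zero_mode (m n : ℕ) {f : ℝ → ℝ} (hf : ContDiff ℝ ∞ f) (a b c d : ℝ) :
    pd 0 (pd 0 (mode m n f a b c d)) = fun X => -(m : ℝ) ^ 2 * mode m n f a b c d X := by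
  rw [pd_zero_mode m n hf, pd_const_mul 0 _ (isSmooth_mode m n hf _ _ _ _), pd_zero_mode m n hf]
  funext X
  simp only [mode, Pw]
  ring

theorem pd_pd_one_mode (m n : ℕ) {f : ℝ → ℝ} (hf : ContDiff ℝ ∞ f) (a b c d : ℝ) :
    pd 1 (pd 1 (mode m n f a b c d)) = fun X => -(n : ℝ) ^ 2 * mode m n f a b c d X := by
  rw [pd_one_mode m n hf, pd_const_mul 1 _ (isSmooth_mode m n hf _ _ _ _), pd_one_mode m n hf]
  funext X
  simp only [mode, Pw]
  ring

theorem pd_pd_two_hMode (m n p : ℕ) (a b c d : ℝ) :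
    pd 2 (pd 2 (mode m n (hProfile p) a b c d)) =
      fun X => -vfreq p ^ 2 * mode m n (hProfile p) a b c d X := by
  rw [pd_two_mode m n (contDiff_hProfile p) _ (hasDerivAt_hProfile p),
    pd_const_mul 2 _ (isSmooth_mode m n (contDiff_vProfile p) _ _ _ _),
    pd_two_mode m n (contDiff_vProfile p) _ (hasDerivAt_vProfile p)]
  funext X
  ring

theorem pd_pd_two_vMode (m n p : ℕ) (a b c d : ℝ) :
    pd 2 (pd 2 (mode m n (vProfile p) a b c d)) =
      fun X => -vfreq p ^ 2 * mode m n (vProfile p) a b c d X := by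
  rw [pd_two_mode m n (contDiff_vProfile p) _ (hasDerivAt_vProfile p),
    pd_const_mul 2 _ (isSmooth_mode m n (contDiff_hProfile p) _ _ _ _),
    pd_two_mode m n (contDiff_hProfile p) _ (hasDerivAt_hProfile p)]
  funext X
  ring

/-- The wave numbers in the three coordinate directions. -/
noncomputable def waveNumber (m n p : ℕ) : Fin 3 → ℝ := ![m, n, vfreq p]

/-- Stated for each direction and not only for the Laplacian, since orthogonality must distinguish
indices with equal eigenvalue. -/
theorem pd_pd_basicField (m n p : ℕ) (a b c d : ℝ) (i j : Fin 3) :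
    pd j (pd j (basicField m n p a b c d i)) =
      fun X => -waveNumber m n p j ^ 2 * basicField m n p a b c d i X := by
  fin_cases j
  · fin_cases i
    · exact pd_pd_zero_mode m n (contDiff_hProfile p) _ _ _ _
    · exact pd_pd_zero_mode m n (contDiff_hProfile p) _ _ _ _
    · exact pd_pd_zero_mode m n (contDiff_vProfile p) _ _ _ _
  · fin_cases i
    · exact pd_pd_one_mode m n (contDiff_hProfile p) _ _ _ _
    · exact pd_pd_one_mode m n (contDiff_hProfile p) _ _ _ _
    · exact pd_pd_one_mode m n (contDiff_vProfile p) _ _ _ _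
  · fin_cases i
    · exact pd_pd_two_hMode m n p _ _ _ _
    · exact pd_pd_two_hMode m n p _ _ _ _
    · exact pd_pd_two_vMode m n p _ _ _ _

theorem eigenvalueN_eq (m n p : ℕ) : eigenvalueN m n p = (m : ℝ) ^ 2 + (n : ℝ) ^ 2 + vfreq p ^ 2 := by
  rw [eigenvalueN, mu, Real.sq_sqrt (by positivity), vfreq_sq]

theorem lap_basicField (m n p : ℕ) (a b c d : ℝ) (i : Fin 3) (X : Pt) :
    lap (basicField m n p a b c d i) X =
      -eigenvalueN m n p * basicField m n p a b c d i X := by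
  simp only [lap, pd_pd_basicField, Fin.sum_univ_three, eigenvalueN_eq, waveNumber,
    Matrix.cons_val_zero, Matrix.cons_val_one, Matrix.cons_val_two, Matrix.tail_cons,
    Matrix.head_cons]
  ring

theorem vMode_eq_zero (m n p : ℕ) (a b c d : ℝ) {X : Pt} (hX : |X.2.2| = 1) :
    mode m n (vProfile p) a b c d X = 0 := by
  rw [mode, vProfile_eq_zero p hX, zero_mul]

theorem pd_two_hMode_eq_zero (m n p : ℕ) (a b c d : ℝ) {X : Pt} (hX : |X.2.2| = 1) :
    pd 2 (mode m n (hProfile p) a b c d) X = 0 := by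
  rw [pd_two_mode m n (contDiff_hProfile p) _ (hasDerivAt_hProfile p)]
  exact mul_eq_zero_of_right _ (vMode_eq_zero m n p _ _ _ _ hX)

theorem isClassicalSolution_sepField (m n p : ℕ) (a b c d U V W Q : ℝ)
    (h : AmplitudeRel m n p U V W) :
    IsClassicalSolution 0 (eigenvalueN m n p) (sepField m n p a b c d U V W) fun _ => Q := by
  have hs := isSmooth_basicField m n p a b c d
  refine ⟨fun i => ?_, isSmooth_const Q, fun X _ i => ?_, fun X _ => ?_, fun X hX => ?_,
    fun X hX j hj => ?_⟩
  · rw [sepField_eq]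
    exact (hs i).const_mul _
  · have h1 : lap (sepField m n p a b c d U V W i) X =
        (![U, V, W] : Fin 3 → ℝ) i * lap (basicField m n p a b c d i) X := by
      rw [sepField_eq]
      simp only [lap, pd_const_mul _ _ (hs i), pd_const_mul _ _ ((hs i).pd _), Finset.mul_sum]
    rw [h1, lap_basicField, pd_const, sepField_eq]
    ring
  · rw [amplitudeRel_iff] at h
    have h1 : ∀ i, pd i (sepField m n p a b c d U V W i) X =
        (gradAmp m n p i * (![U, V, W] : Fin 3 → ℝ) i) *
          -mode m n (hProfile p) a b c d X := by
      intro i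
      rw [sepField_eq, pd_const_mul _ _ (hs i), pd_basicField]
      ring
    rw [Finset.sum_congr rfl fun i _ => h1 i, ← Finset.sum_mul, h, zero_mul]
  · have h2 : sepField m n p a b c d U V W 2 X = 0 := by
      rw [sepField_eq]
      exact mul_eq_zero_of_right _ (vMode_eq_zero m n p a b c d hX)
    simp [Fin.sum_univ_three, nu, h2]
  · have h1 : pd 2 (sepField m n p a b c d U V W j) X = 0 := by
      rw [sepField_eq, pd_const_mul _ _ (hs j)]
      refine mul_eq_zero_of_right _ ?_
      fin_cases j
      · exact pd_two_hMode_eq_zero m n p _ _ _ _ hX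
      · exact pd_two_hMode_eq_zero m n p _ _ _ _ hX
      · exact absurd rfl hj
    have h2 : pd j (sepField m n p a b c d U V W 2) X = 0 := by
      rw [sepField_eq, pd_const_mul _ _ (hs 2)]
      refine mul_eq_zero_of_right _ ?_
      fin_cases j
      · refine (congrFun (pd_zero_mode m n (contDiff_vProfile p) a b c d) X).trans ?_
        exact mul_eq_zero_of_right _ (vMode_eq_zero m n p _ _ _ _ hX)
      · refine (congrFun (pd_one_mode m n (contDiff_vProfile p) a b c d) X).trans ?_
        exact mul_eq_zero_of_right _ (vMode_eq_zero m n p _ _ _ _ hX)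
      · exact absurd rfl hj
    simp [Fin.sum_univ_three, nu, h1, h2]

/-! ### Completeness of the modes -/

/-- The span of the modes with horizontal profiles. -/
noncomputable def modeSpan : Submodule ℝ (Pt → ℝ) :=
  Submodule.span ℝ {g | ∃ (m n p : ℕ) (a b c d : ℝ), g = mode m n (hProfile p) a b c d}

theorem hMode_mem (m n p : ℕ) (a b c d : ℝ) : mode m n (hProfile p) a b c d ∈ modeSpan :=
  Submodule.subset_span ⟨m, n, p, a, b, c, d, rfl⟩

/-! ### Product-to-sum formulas. -/

theorem sin_mul_hProfile (p : ℕ) (z : ℝ) : sin (π / 2 * z) * hProfile (p + 1) z =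
    (if Even p then 1 else -1) * (1 / 2 * (hProfile p z - hProfile (p + 2) z)) := by
  have e1 : π / 2 * ((p + 2 : ℕ) : ℝ) * z = π / 2 * ((p + 1 : ℕ) : ℝ) * z + π / 2 * z := by
    push_cast; ring
  have e2 : π / 2 * (p : ℝ) * z = π / 2 * ((p + 1 : ℕ) : ℝ) * z - π / 2 * z := by
    push_cast; ring
  unfold hProfile
  by_cases h : Even p
  · have h1 : ¬ Even (p + 1) := by simpa [Nat.even_add_one] using h
    have h2 : Even (p + 2) := by simpa [Nat.even_add] using h
    rw [if_pos h, if_neg h1, if_pos h2, if_pos h, e1, e2, cos_add, cos_sub]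
    ring
  · have h1 : Even (p + 1) := by simpa [Nat.even_add_one] using h
    have h2 : ¬ Even (p + 2) := by simpa [Nat.even_add] using h
    rw [if_neg h, if_pos h1, if_neg h2, if_neg h, e1, e2, sin_add, sin_sub]
    ring

/-- The bridge by which completeness passes from horizontal to vertical profiles. -/
theorem cos_mul_hProfile (p : ℕ) (z : ℝ) : cos (π / 2 * z) * hProfile (p + 1) z =
    1 / 2 * (vProfile p z + vProfile (p + 2) z) := by
  have e1 : π / 2 * ((p + 2 : ℕ) : ℝ) * z = π / 2 * ((p + 1 : ℕ) : ℝ) * z + π / 2 * z := by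
    push_cast; ring
  have e2 : π / 2 * (p : ℝ) * z = π / 2 * ((p + 1 : ℕ) : ℝ) * z - π / 2 * z := by
    push_cast; ring
  unfold hProfile vProfile
  by_cases h : Even p
  · have h1 : ¬ Even (p + 1) := by simpa [Nat.even_add_one] using h
    have h2 : Even (p + 2) := by simpa [Nat.even_add] using h
    rw [if_neg h1, if_pos h, if_pos h2, e1, e2, sin_add, sin_sub]
    ring
  · have h1 : Even (p + 1) := by simpa [Nat.even_add_one] using h
    have h2 : ¬ Even (p + 2) := by simpa [Nat.even_add] using h
    rw [if_pos h1, if_neg h, if_neg h2, e1, e2, cos_add, cos_sub]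
    ring

/-- Starting at frequency `m + 1` keeps both shifted frequencies natural numbers; frequency zero is
treated separately in `trigCoord_mul_mem`. -/
theorem mode_mul_cos_x (m n : ℕ) (f : ℝ → ℝ) (a b c d : ℝ) :
    (fun X => cos X.1 * mode (m + 1) n f a b c d X) =
      (1 / 2 : ℝ) • mode (m + 2) n f a b c d + (1 / 2 : ℝ) • mode m n f a b c d := by
  funext ⟨x, y, z⟩
  have e1 : ((m + 2 : ℕ) : ℝ) * x = ((m + 1 : ℕ) : ℝ) * x + x := by push_cast; ring
  have e2 : (m : ℝ) * x = ((m + 1 : ℕ) : ℝ) * x - x := by push_cast; ring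
  simp only [mode, Pw, Pi.add_apply, Pi.smul_apply, smul_eq_mul, e1, e2, cos_add, cos_sub,
    sin_add, sin_sub]
  ring

theorem mode_mul_sin_x (m n : ℕ) (f : ℝ → ℝ) (a b c d : ℝ) :
    (fun X => sin X.1 * mode (m + 1) n f a b c d X) =
      (1 / 2 : ℝ) • mode (m + 2) n f b (-a) (-d) c +
        (1 / 2 : ℝ) • mode m n f (-b) a d (-c) := by
  funext ⟨x, y, z⟩
  have e1 : ((m + 2 : ℕ) : ℝ) * x = ((m + 1 : ℕ) : ℝ) * x + x := by push_cast; ring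
  have e2 : (m : ℝ) * x = ((m + 1 : ℕ) : ℝ) * x - x := by push_cast; ring
  simp only [mode, Pw, Pi.add_apply, Pi.smul_apply, smul_eq_mul, e1, e2, cos_add, cos_sub,
    sin_add, sin_sub]
  ring

theorem mode_mul_cos_y (m n : ℕ) (f : ℝ → ℝ) (a b c d : ℝ) :
    (fun X => cos X.2.1 * mode m (n + 1) f a b c d X) =
      (1 / 2 : ℝ) • mode m (n + 2) f a b c d + (1 / 2 : ℝ) • mode m n f a b c d := by
  funext ⟨x, y, z⟩
  have e1 : ((n + 2 : ℕ) : ℝ) * y = ((n + 1 : ℕ) : ℝ) * y + y := by push_cast; ring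
  have e2 : (n : ℝ) * y = ((n + 1 : ℕ) : ℝ) * y - y := by push_cast; ring
  simp only [mode, Pw, Pi.add_apply, Pi.smul_apply, smul_eq_mul, e1, e2, cos_add, cos_sub,
    sin_add, sin_sub]
  ring

theorem mode_mul_sin_y (m n : ℕ) (f : ℝ → ℝ) (a b c d : ℝ) :
    (fun X => sin X.2.1 * mode m (n + 1) f a b c d X) =
      (1 / 2 : ℝ) • mode m (n + 2) f d c (-b) (-a) +
        (1 / 2 : ℝ) • mode m n f (-d) (-c) b a := by
  funext ⟨x, y, z⟩
  have e1 : ((n + 2 : ℕ) : ℝ) * y = ((n + 1 : ℕ) : ℝ) * y + y := by push_cast; ring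
  have e2 : (n : ℝ) * y = ((n + 1 : ℕ) : ℝ) * y - y := by push_cast; ring
  simp only [mode, Pw, Pi.add_apply, Pi.smul_apply, smul_eq_mul, e1, e2, cos_add, cos_sub,
    sin_add, sin_sub]
  ring

theorem mul_mem_modeSpan_of_modes {F : Pt → ℝ}
    (h : ∀ (m n p : ℕ) (a b c d : ℝ),
      (fun X => F X * mode m n (hProfile p) a b c d X) ∈ modeSpan)
    {t : Pt → ℝ} (ht : t ∈ modeSpan) : (fun X => F X * t X) ∈ modeSpan := by
  induction ht using Submodule.span_induction with
  | mem t ht =>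
    obtain ⟨m, n, p, a, b, c, d, rfl⟩ := ht
    exact h m n p a b c d
  | zero =>
    convert modeSpan.zero_mem using 1
    funext X
    simp
  | add s t _ _ hs ht =>
    have := modeSpan.add_mem hs ht
    convert this using 1
    funext X
    simp [mul_add]
  | smul r t _ ht =>
    have := modeSpan.smul_mem r ht
    convert this using 1
    funext X
    simp only [Pi.smul_apply, smul_eq_mul]
    ring

/-- Coordinates that separate the points of the period cell. -/
noncomputable def trigCoord : Fin 5 → Pt → ℝ :=
  ![fun X => cos X.1, fun X => sin X.1, fun X => cos X.2.1, fun X => sin X.2.1,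
    fun X => sin (π / 2 * X.2.2)]

theorem trigCoord_mul_mem (j : Fin 5) {t : Pt → ℝ} (ht : t ∈ modeSpan) :
    (fun X => trigCoord j X * t X) ∈ modeSpan := by
  have comb : ∀ {s t : Pt → ℝ} (r r' : ℝ), s ∈ modeSpan → t ∈ modeSpan →
      r • s + r' • t ∈ modeSpan := fun r r' hs ht =>
    modeSpan.add_mem (modeSpan.smul_mem r hs) (modeSpan.smul_mem r' ht)
  refine mul_mem_modeSpan_of_modes (fun m n p a b c d => ?_) ht
  fin_cases j
  · change (fun X : Pt => cos X.1 * mode m n (hProfile p) a b c d X) ∈ modeSpan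
    rcases m with _ | m
    -- At frequency zero in `x` only the coefficients `b` and `c` are visible.
    · convert hMode_mem 1 n p 0 b c 0 using 1
      funext X; simp only [mode, Pw, Nat.cast_zero, Nat.cast_one, zero_mul, one_mul, sin_zero,
        cos_zero]; ring
    · rw [mode_mul_cos_x]
      exact comb _ _ (hMode_mem _ _ _ _ _ _ _) (hMode_mem _ _ _ _ _ _ _)
  · change (fun X : Pt => sin X.1 * mode m n (hProfile p) a b c d X) ∈ modeSpan
    rcases m with _ | m
    · convert hMode_mem 1 n p b 0 0 c using 1
      funext X; simp only [mode, Pw, Nat.cast_zero, Nat.cast_one, zero_mul, one_mul, sin_zero,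
        cos_zero]; ring
    · rw [mode_mul_sin_x]
      exact comb _ _ (hMode_mem _ _ _ _ _ _ _) (hMode_mem _ _ _ _ _ _ _)
  · change (fun X : Pt => cos X.2.1 * mode m n (hProfile p) a b c d X) ∈ modeSpan
    rcases n with _ | n
    · convert hMode_mem m 1 p 0 0 c d using 1
      funext X; simp only [mode, Pw, Nat.cast_zero, Nat.cast_one, zero_mul, one_mul, sin_zero,
        cos_zero]; ring
    · rw [mode_mul_cos_y]
      exact comb _ _ (hMode_mem _ _ _ _ _ _ _) (hMode_mem _ _ _ _ _ _ _)
  · change (fun X : Pt => sin X.2.1 * mode m n (hProfile p) a b c d X) ∈ modeSpan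
    rcases n with _ | n
    · convert hMode_mem m 1 p d c 0 0 using 1
      funext X; simp only [mode, Pw, Nat.cast_zero, Nat.cast_one, zero_mul, one_mul, sin_zero,
        cos_zero]; ring
    · rw [mode_mul_sin_y]
      exact comb _ _ (hMode_mem _ _ _ _ _ _ _) (hMode_mem _ _ _ _ _ _ _)
  · change (fun X : Pt => sin (π / 2 * X.2.2) * mode m n (hProfile p) a b c d X) ∈ modeSpan
    rcases p with _ | p
    · convert hMode_mem m n 1 a b c d using 1
      funext X; simp [mode, hProfile]
    · convert comb ((if Even p then 1 else -1) * (1 / 2)) (-((if Even p then 1 else -1) * (1 / 2)))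
        (hMode_mem m n p a b c d) (hMode_mem m n (p + 2) a b c d) using 1
      funext X
      simp only [mode, Pi.add_apply, Pi.smul_apply, smul_eq_mul, ← mul_assoc, sin_mul_hProfile]
      ring

/-! ### Uniqueness of Fourier coefficients by Stone–Weierstrass. -/

theorem continuous_trigCoord (j : Fin 5) : Continuous (trigCoord j) := by
  fin_cases j
  · exact continuous_cos.comp (by fun_prop)
  · exact continuous_sin.comp (by fun_prop)
  · exact continuous_cos.comp (by fun_prop)
  · exact continuous_sin.comp (by fun_prop)
  · exact continuous_sin.comp (by fun_prop)

theorem trigCoord_mem_Icc (j : Fin 5) (X : Pt) : trigCoord j X ∈ Set.Icc (-1 : ℝ) 1 := by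
  fin_cases j
  · exact cos_mem_Icc _
  · exact sin_mem_Icc _
  · exact cos_mem_Icc _
  · exact sin_mem_Icc _
  · exact sin_mem_Icc _

/-- The map of the period cell to a cube given by the trigonometric coordinates. -/
noncomputable def trigMap (X : Pt) : Fin 5 → Set.Icc (-1 : ℝ) 1 :=
  fun j => ⟨trigCoord j X, trigCoord_mem_Icc j X⟩

theorem continuous_trigMap : Continuous trigMap :=
  continuous_pi fun j => (continuous_trigCoord j).subtype_mk _

theorem eq_of_cos_sin_eq {s t : ℝ} (hs : s ∈ Set.Ioc 0 (2 * π)) (ht : t ∈ Set.Ioc 0 (2 * π))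
    (hc : cos s = cos t) (hsin : sin s = sin t) : s = t := by
  have h1 := Real.Angle.cos_sin_inj hc hsin
  obtain ⟨k, hk⟩ := Real.Angle.angle_eq_iff_two_pi_dvd_sub.1 h1
  have hpi := pi_pos
  have h2 : (k : ℝ) < 1 := by
    by_contra! h
    nlinarith [hs.1, hs.2, ht.1, ht.2]
  have h3 : (-1 : ℝ) < k := by
    by_contra! h
    nlinarith [hs.1, hs.2, ht.1, ht.2]
  have h4 : k = 0 := by
    have h2' : k < 1 := by exact_mod_cast h2
    have h3' : -1 < k := by exact_mod_cast h3
    omega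
  rw [h4] at hk
  simp at hk
  linarith

/-- Cosine and sine together determine a point of a half-open period, and `sin (π z / 2)` alone
suffices for `z` because it is injective on `(-1, 1)`. -/
theorem injOn_trigMap : Set.InjOn trigMap
    (Set.Ioc 0 (2 * π) ×ˢ Set.Ioc 0 (2 * π) ×ˢ Set.Ioo (-1) 1) := by
  rintro ⟨x, y, z⟩ ⟨hx, hy, hz⟩ ⟨x', y', z'⟩ ⟨hx', hy', hz'⟩ h
  have key : ∀ j, trigCoord j (x, y, z) = trigCoord j (x', y', z') := fun j =>
    congrArg Subtype.val (congrFun h j)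
  have h1 : x = x' := eq_of_cos_sin_eq hx hx' (key 0) (key 1)
  have h2 : y = y' := eq_of_cos_sin_eq hy hy' (key 2) (key 3)
  have hpi := pi_pos
  have h3 : π / 2 * z = π / 2 * z' := by
    refine injOn_sin ?_ ?_ (key 4)
    · constructor <;> nlinarith [hz.1, hz.2]
    · constructor <;> nlinarith [hz'.1, hz'.2]
  have h4 : z = z' := mul_left_cancel₀ (by positivity) h3
  rw [h1, h2, h4]

/-- The coordinates of the cube. -/
noncomputable def cubeCoord (j : Fin 5) :
    BoundedContinuousFunction (Fin 5 → Set.Icc (-1 : ℝ) 1) ℝ :=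
  BoundedContinuousFunction.mkOfCompact ⟨fun v => (v j : ℝ), by fun_prop⟩

/-- Quantifying over all `t` in `modeSpan` makes the product step of the induction a composition.
With `t = 1`, every polynomial in the trigonometric coordinates is a combination of modes. -/
theorem comp_trigMap_mul_mem {g : BoundedContinuousFunction (Fin 5 → Set.Icc (-1 : ℝ) 1) ℝ}
    (hg : g ∈ StarAlgebra.adjoin ℝ (Set.range cubeCoord)) :
    ∀ t ∈ modeSpan, (fun X => g (trigMap X) * t X) ∈ modeSpan := by
  induction hg using StarAlgebra.adjoin_induction with
  | mem g hg =>
    obtain ⟨j, rfl⟩ := hg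
    intro t ht
    exact trigCoord_mul_mem j ht
  | algebraMap r =>
    intro t ht
    exact modeSpan.smul_mem r ht
  | add g h _ _ hg hh =>
    intro t ht
    have := modeSpan.add_mem (hg t ht) (hh t ht)
    convert this using 1
    funext X
    simp [add_mul]
  | mul g h _ _ hg hh =>
    intro t ht
    have := hg _ (hh t ht)
    convert this using 1
    funext X
    simp [mul_assoc]
  | star g _ hg =>
    intro t ht
    simpa using hg t ht

theorem integral_mul_eq_zero_of_mem_modeSpan {f : Pt → ℝ} (hf : Integrable f volΩ)
    (h : ∀ (m n p : ℕ) (a b c d : ℝ), ∫ X, f X * mode m n (hProfile p) a b c d X ∂volΩ = 0)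
    {t : Pt → ℝ} (ht : t ∈ modeSpan) :
    Integrable (fun X => f X * t X) volΩ ∧ ∫ X, f X * t X ∂volΩ = 0 := by
  induction ht using Submodule.span_induction with
  | mem t ht =>
    obtain ⟨m, n, p, a, b, c, d, rfl⟩ := ht
    refine ⟨?_, h m n p a b c d⟩
    have hc := (isSmooth_hMode m n p a b c d).continuous
    obtain ⟨C, hC⟩ := exists_bound_cell hc
    exact hf.mul_bdd (c := C) hc.aestronglyMeasurable (ae_mem_cell.mono hC)
  | zero => simp
  | add s t _ _ hs ht =>
    simp only [Pi.add_apply, mul_add]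
    exact ⟨hs.1.add ht.1, by rw [integral_add hs.1 ht.1, hs.2, ht.2, add_zero]⟩
  | smul r t _ ht =>
    simp only [Pi.smul_apply, smul_eq_mul, mul_left_comm _ r]
    exact ⟨ht.1.const_mul r, by rw [integral_const_mul, ht.2, mul_zero]⟩

/-- Both measures are carried by the half-open cell, where `trigMap` is injective; injective
measurable images of Borel sets are Borel, so the push-forward determines the measure. -/
theorem measure_eq_of_map_trigMap_eq {ν ν' : Measure Pt} (hν : ν ≪ volΩ) (hν' : ν' ≪ volΩ)
    (h : ν.map trigMap = ν'.map trigMap) : ν = ν' := by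
  set C : Set Pt := Set.Ioc 0 (2 * π) ×ˢ Set.Ioc 0 (2 * π) ×ˢ Set.Ioo (-1) 1 with hCdef
  have hC : volΩ Cᶜ = 0 := by
    rw [volΩ, Measure.restrict_apply measurableSet_openCell.compl, Set.compl_inter_self,
      measure_empty]
  have key : ∀ {ρ : Measure Pt}, ρ ≪ volΩ → ∀ A, MeasurableSet A →
      ρ A = ρ.map trigMap (trigMap '' (A ∩ C)) := by
    intro ρ hρ A hA
    have hAC := hA.inter measurableSet_openCell
    rw [Measure.map_apply continuous_trigMap.measurable
      (hAC.image_of_measurable_injOn continuous_trigMap.measurable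
        (injOn_trigMap.mono Set.inter_subset_right))]
    have h0 : ∀ᵐ X ∂ρ, X ∈ C := hρ hC
    refine measure_congr ?_
    filter_upwards [h0] with X hX
    refine propext ⟨fun hXA => ⟨X, ⟨hXA, hX⟩, rfl⟩, ?_⟩
    rintro ⟨Y, ⟨hYA, hYC⟩, hY⟩
    have := injOn_trigMap hYC hX hY
    change X ∈ A
    rwa [← this]
  refine Measure.ext fun A hA => ?_
  rw [key hν A hA, key hν' A hA, h]

/-- An integrable function with vanishing Fourier coefficients vanishes. -/
theorem ae_eq_zero_of_integral_hMode {f : Pt → ℝ} (hm : Measurable f) (hf : Integrable f volΩ)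
    (h : ∀ (m n p : ℕ) (a b c d : ℝ), ∫ X, f X * mode m n (hProfile p) a b c d X ∂volΩ = 0) :
    f =ᵐ[volΩ] 0 := by
  have hm1 : Measurable fun X => (f X).toNNReal := hm.real_toNNReal
  have hm2 : Measurable fun X => (-f X).toNNReal := hm.neg.real_toNNReal
  -- The positive and negative parts of `f` become finite measures. Vanishing coefficients say that
  -- their push-forwards integrate polynomials on the cube equally, and polynomials separate points.
  let ν : Measure Pt := volΩ.withDensity fun X => ((f X).toNNReal : ENNReal)
  let ν' : Measure Pt := volΩ.withDensity fun X => ((-f X).toNNReal : ENNReal)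
  have : IsFiniteMeasure ν := isFiniteMeasure_withDensity_ofReal hf.2
  have : IsFiniteMeasure ν' := isFiniteMeasure_withDensity_ofReal hf.neg.2
  have hmap : ν.map trigMap = ν'.map trigMap := by
    refine ext_of_forall_mem_subalgebra_integral_eq_of_pseudoEMetric_complete_countable
      (𝕜 := ℝ) (A := StarAlgebra.adjoin ℝ (Set.range cubeCoord)) ?_ fun g hg => ?_
    · intro v w hvw
      obtain ⟨j, hj⟩ := Function.ne_iff.1 hvw
      refine ⟨cubeCoord j, ⟨_, ⟨cubeCoord j, StarAlgebra.subset_adjoin _ _ ⟨j, rfl⟩, rfl⟩, rfl⟩, ?_⟩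
      exact fun h => hj (Subtype.ext h)
    · have hgc := g.continuous.comp continuous_trigMap
      have hone : (fun _ : Pt => (1 : ℝ)) ∈ modeSpan := by
        convert hMode_mem 0 0 0 0 0 1 0 using 1
        funext X
        simp [mode, hProfile, Pw]
      have h1 := (integral_mul_eq_zero_of_mem_modeSpan hf h (comp_trigMap_mul_mem hg _ hone)).2
      simp only [mul_one] at h1
      obtain ⟨D, hD⟩ := exists_bound_cell hgc
      have hi1 : Integrable (fun X => ((f X).toNNReal : ℝ) * g (trigMap X)) volΩ :=
        hf.real_toNNReal.mul_bdd (c := D) hgc.aestronglyMeasurable (ae_mem_cell.mono hD)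
      have hi2 : Integrable (fun X => ((-f X).toNNReal : ℝ) * g (trigMap X)) volΩ :=
        hf.neg.real_toNNReal.mul_bdd (c := D) hgc.aestronglyMeasurable (ae_mem_cell.mono hD)
      rw [integral_map continuous_trigMap.aemeasurable g.continuous.aestronglyMeasurable,
        integral_map continuous_trigMap.aemeasurable g.continuous.aestronglyMeasurable,
        integral_withDensity_eq_integral_smul hm1, integral_withDensity_eq_integral_smul hm2]
      simp only [NNReal.smul_def, smul_eq_mul]
      rw [← sub_eq_zero, ← integral_sub hi1 hi2, ← h1]
      congr 1
      funext X
      rw [← sub_mul, Real.coe_toNNReal', Real.coe_toNNReal', max_zero_sub_max_neg_zero_eq_self]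
  have heq := measure_eq_of_map_trigMap_eq (withDensity_absolutelyContinuous _ _)
    (withDensity_absolutelyContinuous _ _) hmap
  have h2 := (withDensity_eq_iff hm1.coe_nnreal_ennreal.aemeasurable
    hm2.coe_nnreal_ennreal.aemeasurable hf.lintegral_lt_top.ne).1 heq
  filter_upwards [h2] with X hX
  have hX' : ((f X).toNNReal : ℝ) = ((-f X).toNNReal : ℝ) := by exact_mod_cast hX
  rw [Real.coe_toNNReal', Real.coe_toNNReal'] at hX'
  simp only [Pi.zero_apply]
  rcases le_total 0 (f X) with h0 | h0
  · rw [max_eq_left h0, max_eq_right (by linarith)] at hX'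
    exact hX'
  · rw [max_eq_right h0, max_eq_left (by linarith)] at hX'
    linarith

theorem L2_eq_zero_of_hModes {f : L2}
    (h : ∀ (m n p : ℕ) (a b c d : ℝ), ∫ X, f X * mode m n (hProfile p) a b c d X ∂volΩ = 0) :
    f = 0 :=
  Lp.ext ((ae_eq_zero_of_integral_hMode (Lp.stronglyMeasurable f).measurable
    ((Lp.memLp f).integrable (by norm_num)) h).trans (Lp.coeFn_zero ℝ 2 volΩ).symm)

/-- The product of `f` with `cos (π z / 2)` has vanishing horizontal coefficients, since the cosine
turns horizontal profiles into combinations of vertical ones; the cosine is positive on `(-1, 1)`.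
-/
theorem L2_eq_zero_of_vModes {f : L2}
    (h : ∀ (m n p : ℕ) (a b c d : ℝ), ∫ X, f X * mode m n (vProfile p) a b c d X ∂volΩ = 0) :
    f = 0 := by
  have hc : Continuous fun X : Pt => cos (π / 2 * X.2.2) := by fun_prop
  have h1 : (fun X => f X * cos (π / 2 * X.2.2)) =ᵐ[volΩ] 0 := by
    refine ae_eq_zero_of_integral_hMode
      ((Lp.stronglyMeasurable f).measurable.mul hc.measurable) (integrable_L2_mul f hc) ?_
    intro m n p a b c d
    rcases p with _ | p
    · rw [← h m n 1 a b c d]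
      congr 1
      funext X
      simp [mode, hProfile, vProfile, mul_assoc]
    · have e1 := h m n p a b c d
      have e2 := h m n (p + 2) a b c d
      have e3 : ∀ X : Pt, f X * cos (π / 2 * X.2.2) * mode m n (hProfile (p + 1)) a b c d X =
          1 / 2 * (f X * mode m n (vProfile p) a b c d X) +
            1 / 2 * (f X * mode m n (vProfile (p + 2)) a b c d X) := by
        intro X
        have := cos_mul_hProfile p X.2.2
        simp only [mode]
        linear_combination f X * Pw m n a b c d X.1 X.2.1 * this
      have hi : ∀ q, Integrable (fun X => 1 / 2 * (f X * mode m n (vProfile q) a b c d X)) volΩ :=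
        fun q => (integrable_L2_mul f
          (isSmooth_mode m n (contDiff_vProfile q) a b c d).continuous).const_mul _
      simp only [e3]
      rw [integral_add (hi p) (hi (p + 2)), integral_const_mul, integral_const_mul, e1, e2]
      simp
  refine Lp.ext (EventuallyEq.trans ?_ (Lp.coeFn_zero ℝ 2 volΩ).symm)
  have h2 : ∀ᵐ X ∂volΩ, 0 < cos (π / 2 * X.2.2) := by
    refine ae_volΩ fun x y z _ _ hz => cos_pos_of_mem_Ioo ?_
    have := pi_pos
    constructor <;> nlinarith [hz.1, hz.2]
  filter_upwards [h1, h2] with X hX hX'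
  exact (mul_eq_zero.1 hX).resolve_right hX'.ne'

/-! ### Separated fields in `L²(Ω)³` -/

/-- The inner product of `L²(Ω)³`. -/
noncomputable def dot : LinearMap.BilinForm ℝ L2Field :=
  LinearMap.mk₂ ℝ (fun u v => ∑ i, inner ℝ (u i) (v i))
    (fun u v w => by simp only [Pi.add_apply, inner_add_left, Finset.sum_add_distrib])
    (fun c u v => by
      simp only [Pi.smul_apply, inner_smul_left, RCLike.conj_to_real, Finset.mul_sum, smul_eq_mul])
    (fun u v w => by simp only [Pi.add_apply, inner_add_right, Finset.sum_add_distrib])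
    (fun c u v => by simp only [Pi.smul_apply, inner_smul_right, Finset.mul_sum, smul_eq_mul])

theorem dot_apply (u v : L2Field) : dot u v = ∑ i, inner ℝ (u i) (v i) := rfl

theorem dot_comm (u v : L2Field) : dot u v = dot v u := by
  simp only [dot_apply, real_inner_comm]

theorem eq_zero_of_dot_self {u : L2Field} (h : dot u u = 0) : u = 0 := by
  rw [dot_apply, Finset.sum_eq_zero_iff_of_nonneg fun i _ => real_inner_self_nonneg] at h
  funext i
  exact inner_self_eq_zero.1 (h i (Finset.mem_univ i))

/-- `L2Field` is a plain product, so the projection comes from `dot`: its restriction to `S` is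
positive definite, hence injective into the dual of `S`, hence onto by dimension. -/
theorem exists_add_orthogonal (S : Submodule ℝ L2Field) [FiniteDimensional ℝ S] (u : L2Field) :
    ∃ s ∈ S, ∃ w, (∀ v ∈ S, dot v w = 0) ∧ s + w = u := by
  have hinj : Function.Injective (dot.restrict S) := by
    rw [injective_iff_map_eq_zero]
    intro s hs
    exact Subtype.ext (eq_zero_of_dot_self (LinearMap.congr_fun hs s))
  have hsurj := (LinearMap.injective_iff_surjective_of_finrank_eq_finrank
    (Subspace.dual_finrank_eq (K := ℝ) (V := S)).symm).1 hinj
  obtain ⟨s, hs⟩ := hsurj ((dot u).comp S.subtype)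
  refine ⟨s, s.2, u - s, fun v hv => ?_, add_sub_cancel _ _⟩
  have h1 : dot s v = dot u v := LinearMap.congr_fun hs ⟨v, hv⟩
  rw [map_sub, dot_comm v u, dot_comm v s, h1, sub_self]

/-- The class of a separated field in `L²(Ω)³`. -/
noncomputable def sepL2 (m n p : ℕ) (a b c d U V W : ℝ) : L2Field :=
  fun i => toL2 (sepField m n p a b c d U V W i)

theorem isSmooth_sepField (m n p : ℕ) (a b c d U V W : ℝ) (i : Fin 3) :
    IsSmooth (sepField m n p a b c d U V W i) := by
  rw [sepField_eq]
  exact (isSmooth_basicField m n p a b c d i).const_mul _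

theorem sepL2_apply (m n p : ℕ) (a b c d U V W : ℝ) (i : Fin 3) :
    sepL2 m n p a b c d U V W i =
      (![U, V, W] : Fin 3 → ℝ) i • toL2 (basicField m n p a b c d i) := by
  rw [sepL2, sepField_eq, toL2_const_mul _ (isSmooth_basicField m n p a b c d i).continuous]

theorem sepSpace_eq_span (m n p : ℕ) : sepSpace m n p = Submodule.span ℝ
    {u | ∃ a b c d U V W : ℝ, AmplitudeRel m n p U V W ∧ u = sepL2 m n p a b c d U V W} := by
  rw [sepSpace]
  congr 1
  ext u
  constructor
  · rintro ⟨a, b, c, d, U, V, W, h, hu⟩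
    exact ⟨a, b, c, d, U, V, W, h, funext fun i =>
      eq_toL2 (isSmooth_sepField m n p a b c d U V W i).continuous (hu i)⟩
  · rintro ⟨a, b, c, d, U, V, W, h, rfl⟩
    exact ⟨a, b, c, d, U, V, W, h, fun i =>
      coeFn_toL2 (isSmooth_sepField m n p a b c d U V W i).continuous⟩

theorem sepL2_mem (m n p : ℕ) (a b c d U V W : ℝ) (h : AmplitudeRel m n p U V W) :
    sepL2 m n p a b c d U V W ∈ sepSpace m n p := by
  rw [sepSpace_eq_span]
  exact Submodule.subset_span ⟨a, b, c, d, U, V, W, h, rfl⟩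

theorem sepSpace_le_weakSolutions (m n p : ℕ) :
    sepSpace m n p ≤ weakSolutions (eigenvalueN m n p) := by
  rw [sepSpace_eq_span, Submodule.span_le]
  rintro _ ⟨a, b, c, d, U, V, W, h, rfl⟩
  exact (isClassicalSolution_sepField m n p a b c d U V W 0 h).isWeakSolution

theorem sepSpace_le_veryWeakSolutions (m n p : ℕ) :
    sepSpace m n p ≤ veryWeakSolutions (eigenvalueN m n p) := by
  rw [sepSpace_eq_span, Submodule.span_le]
  rintro _ ⟨a, b, c, d, U, V, W, h, rfl⟩
  exact (isClassicalSolution_sepField m n p a b c d U V W 0 h).isVeryWeakSolution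

/-- The separated fields are complete in `H`. -/
theorem MemH.eq_zero_of_dot_sepL2 {u : L2Field} (hu : MemH u)
    (h : ∀ (m n p : ℕ) (a b c d U V W : ℝ), AmplitudeRel m n p U V W →
      dot u (sepL2 m n p a b c d U V W) = 0) : u = 0 := by
  have key : ∀ (m n p : ℕ) (a b c d : ℝ) (i : Fin 3),
      ∫ X, u i X * basicField m n p a b c d i X ∂volΩ = 0 := by
    intro m n p a b c d
    -- The coefficients of `u` are used as amplitudes. They are admissible by the zero normal trace,
    -- and the inner product of `u` with the resulting field is `∑ i, x i * x i`.
    set x : Fin 3 → ℝ := fun i => inner ℝ (u i) (toL2 (basicField m n p a b c d i)) with hx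
    have hxi : ∀ i, x i = ∫ X, u i X * basicField m n p a b c d i X ∂volΩ := fun i =>
      inner_toL2 _ (isSmooth_basicField m n p a b c d i).continuous
    have hx3 : (![x 0, x 1, x 2] : Fin 3 → ℝ) = x := by
      funext i; fin_cases i <;> rfl
    have h1 : ∑ i, gradAmp m n p i * x i = 0 := by
      have := hu.2 _ (isSmooth_hMode m n p a b c d)
      rw [← this]
      refine Finset.sum_congr rfl fun i _ => ?_
      rw [hxi, pd_hMode, ← integral_const_mul]
      congr 1
      funext X
      ring
    have h2 := h m n p a b c d (x 0) (x 1) (x 2)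
      ((amplitudeRel_iff m n p _ _ _).2 (by rw [hx3]; exact h1))
    simp only [dot_apply, sepL2_apply, hx3, inner_smul_right] at h2
    have h3 := (Finset.sum_eq_zero_iff_of_nonneg fun i _ => mul_self_nonneg (x i)).1 h2
    intro i
    rw [← hxi]
    exact mul_self_eq_zero.1 (h3 i (Finset.mem_univ i))
  funext i
  fin_cases i
  · refine L2_eq_zero_of_hModes fun m n p a b c d => ?_
    -- These coefficients undo the signed permutation in the first component of `basicField`.
    have := key m n p b (-a) (-d) c 0
    simpa [basicField] using this
  · refine L2_eq_zero_of_hModes fun m n p a b c d => ?_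
    have := key m n p d c (-b) (-a) 1
    simpa [basicField] using this
  · exact L2_eq_zero_of_vModes fun m n p a b c d => key m n p a b c d 2

/-! ### Orthogonality -/

/-- Horizontal components satisfy a Neumann condition on `Γ` and the vertical one a Dirichlet
condition, so `∂₃²` is symmetric on each. -/
theorem basicField_mul_pd_two (m n p m' n' p' : ℕ) (a b c d a' b' c' d' : ℝ) (i : Fin 3) {X : Pt}
    (hX : |X.2.2| = 1) : basicField m n p a b c d i X *
      pd 2 (basicField m' n' p' a' b' c' d' i) X = 0 := by
  fin_cases i
  · exact mul_eq_zero_of_right _ (pd_two_hMode_eq_zero m' n' p' _ _ _ _ hX)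
  · exact mul_eq_zero_of_right _ (pd_two_hMode_eq_zero m' n' p' _ _ _ _ hX)
  · exact mul_eq_zero_of_left (vMode_eq_zero m n p _ _ _ _ hX) _

theorem exists_waveNumber_ne {m n p m' n' p' : ℕ} (h : (m, n, p) ≠ (m', n', p')) :
    ∃ j, waveNumber m n p j ^ 2 ≠ waveNumber m' n' p' j ^ 2 := by
  by_contra! hc
  apply h
  have h0 : (m : ℝ) ^ 2 = (m' : ℝ) ^ 2 := hc 0
  have h1 : (n : ℝ) ^ 2 = (n' : ℝ) ^ 2 := hc 1
  have h2 : vfreq p ^ 2 = vfreq p' ^ 2 := hc 2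
  rw [vfreq_sq, vfreq_sq] at h2
  have h2' : (p : ℝ) ^ 2 = (p' : ℝ) ^ 2 := mul_left_cancel₀ (by positivity) h2
  have inj : ∀ {s t : ℕ}, (s : ℝ) ^ 2 = (t : ℝ) ^ 2 → s = t := fun hst => by
    exact_mod_cast (pow_left_inj₀ (Nat.cast_nonneg _) (Nat.cast_nonneg _) two_ne_zero).1 hst
  rw [inj h0, inj h1, inj h2']

/-- Different indices may share an eigenvalue of the Laplacian, but some single `∂ⱼ²` has different
eigenvalues on the two modes, and it is symmetric. -/
theorem integral_basicField_mul {m n p m' n' p' : ℕ} (h : (m, n, p) ≠ (m', n', p'))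
    (a b c d a' b' c' d' : ℝ) (i : Fin 3) :
    ∫ X, basicField m n p a b c d i X * basicField m' n' p' a' b' c' d' i X ∂volΩ = 0 := by
  obtain ⟨j, hj⟩ := exists_waveNumber_ne h
  have hf := isSmooth_basicField m n p a b c d i
  have hg := isSmooth_basicField m' n' p' a' b' c' d' i
  have h1 := integral_mul_pd j hf (hg.pd j) fun hj X hX => by
    subst hj
    exact basicField_mul_pd_two m n p m' n' p' a b c d a' b' c' d' i hX
  have h2 := integral_mul_pd j hg (hf.pd j) fun hj X hX => by
    subst hj
    exact basicField_mul_pd_two m' n' p' m n p a' b' c' d' a b c d i hX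
  rw [pd_pd_basicField] at h1 h2
  simp only [mul_left_comm _ (-_ : ℝ), integral_const_mul] at h1 h2
  simp only [mul_comm (basicField m' n' p' a' b' c' d' i _),
    mul_comm (pd j (basicField m' n' p' a' b' c' d' i) _)] at h2
  have h3 : (waveNumber m n p j ^ 2 - waveNumber m' n' p' j ^ 2) *
      ∫ X, basicField m n p a b c d i X * basicField m' n' p' a' b' c' d' i X ∂volΩ = 0 := by
    linarith
  exact (mul_eq_zero.1 h3).resolve_left (sub_ne_zero.2 hj)

theorem dot_sepSpace {m n p m' n' p' : ℕ} (h : (m, n, p) ≠ (m', n', p')) {u v : L2Field}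
    (hu : u ∈ sepSpace m n p) (hv : v ∈ sepSpace m' n' p') : dot u v = 0 := by
  rw [sepSpace_eq_span] at hu hv
  induction hu, hv using Submodule.span_induction₂ with
  | mem_mem u v hu hv =>
    obtain ⟨a, b, c, d, U, V, W, -, rfl⟩ := hu
    obtain ⟨a', b', c', d', U', V', W', -, rfl⟩ := hv
    rw [dot_apply]
    refine Finset.sum_eq_zero fun i _ => ?_
    rw [sepL2_apply, sepL2_apply, inner_smul_left, inner_smul_right,
      toL2_inner_toL2 (isSmooth_basicField ..).continuous (isSmooth_basicField ..).continuous,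
      integral_basicField_mul h, mul_zero, mul_zero]
  | zero_left v _ => simp
  | zero_right u _ => simp
  | add_left u u' v _ _ _ h1 h2 => rw [map_add, LinearMap.add_apply, h1, h2, add_zero]
  | add_right u v v' _ _ _ h1 h2 => rw [map_add, h1, h2, add_zero]
  | smul_left r u v _ _ h1 => rw [map_smul, LinearMap.smul_apply, h1, smul_zero]
  | smul_right r u v _ _ h1 => rw [map_smul, h1, smul_zero]

theorem iSupIndep_sepSpace :
    iSupIndep fun t : ℕ × ℕ × ℕ => sepSpace t.1 t.2.1 t.2.2 := by
  intro t
  rw [Submodule.disjoint_def]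
  intro u hu hu'
  have hle : ⨆ s, ⨆ (_ : s ≠ t), sepSpace s.1 s.2.1 s.2.2 ≤
      LinearMap.ker (dot u) := by
    refine iSup_le fun s => iSup_le fun hs v hv => ?_
    exact dot_sepSpace (Ne.symm hs) hu hv
  exact eq_zero_of_dot_self (hle hu')

/-! ### Coordinates in the spaces of separated fields -/

/-- The field whose `i`-th component is the mode with the coefficients `x i`. -/
noncomputable def fieldOfCoeffs (m n p : ℕ) : (Fin 3 → Fin 4 → ℝ) →ₗ[ℝ] L2Field where
  toFun x i := toL2 (basicField m n p (x i 0) (x i 1) (x i 2) (x i 3) i)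
  map_add' x y := by
    funext i
    refine Eq.trans ?_ (toL2_add (isSmooth_basicField ..).continuous
      (isSmooth_basicField ..).continuous)
    congr 1
    funext X
    fin_cases i <;> simp [basicField, mode, Pw] <;> ring
  map_smul' r x := by
    funext i
    refine Eq.trans ?_ (toL2_const_mul _ (isSmooth_basicField ..).continuous)
    congr 1
    funext X
    fin_cases i <;> simp [basicField, mode, Pw] <;> ring

/-- The coefficients that satisfy the amplitude relation. -/
noncomputable def relCoeffs (m n p : ℕ) : Submodule ℝ (Fin 3 → Fin 4 → ℝ) where
  carrier := {x | ∀ k, ∑ i, gradAmp m n p i * x i k = 0}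
  add_mem' := fun {x y} hx hy k => by
    simp only [Pi.add_apply, mul_add, Finset.sum_add_distrib, hx k, hy k, add_zero]
  zero_mem' := fun k => by simp
  smul_mem' := fun r x hx k => by
    simp only [Pi.smul_apply, smul_eq_mul, mul_left_comm _ r, ← Finset.mul_sum, hx k, mul_zero]

theorem mem_relCoeffs {m n p : ℕ} {x : Fin 3 → Fin 4 → ℝ} :
    x ∈ relCoeffs m n p ↔ ∀ k, m * x 0 k + n * x 1 k = vfreq p * x 2 k := by
  refine forall_congr' fun k => ?_
  simp only [Fin.sum_univ_three, gradAmp, Matrix.cons_val_zero, Matrix.cons_val_one,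
    Matrix.cons_val_two, Matrix.tail_cons, Matrix.head_cons]
  constructor <;> intro h <;> linarith

theorem sepL2_eq_fieldOfCoeffs (m n p : ℕ) (q : Fin 4 → ℝ) (A : Fin 3 → ℝ) :
    sepL2 m n p (q 0) (q 1) (q 2) (q 3) (A 0) (A 1) (A 2) =
      fieldOfCoeffs m n p fun i k => A i * q k := by
  funext i
  change toL2 _ = toL2 _
  congr 1
  rw [sepField_eq]
  funext X
  fin_cases i <;> simp [basicField, mode, Pw] <;> ring

/-- A separated field has the rank-one coefficient matrix `A i * q k` with `A` subject to the linear
relation. Splitting a matrix into its columns shows that such matrices span all those whose columns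
satisfy the relation. -/
theorem sepSpace_eq_map (m n p : ℕ) :
    sepSpace m n p = (relCoeffs m n p).map (fieldOfCoeffs m n p) := by
  apply le_antisymm
  · rw [sepSpace_eq_span, Submodule.span_le]
    rintro _ ⟨a, b, c, d, U, V, W, h, rfl⟩
    refine ⟨_, fun k => ?_, (sepL2_eq_fieldOfCoeffs m n p ![a, b, c, d] ![U, V, W]).symm⟩
    rw [amplitudeRel_iff] at h
    simp only [← mul_assoc, ← Finset.sum_mul, h, zero_mul]
  · rintro _ ⟨x, hx, rfl⟩
    have h1 : x = ∑ k, fun i l => x i k * (Pi.single k 1 : Fin 4 → ℝ) l := by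
      funext i l
      simp [Finset.sum_apply, Pi.single_apply]
    rw [h1, map_sum]
    refine Submodule.sum_mem _ fun k _ => ?_
    rw [← sepL2_eq_fieldOfCoeffs m n p (Pi.single k 1) fun i => x i k]
    refine sepL2_mem m n p _ _ _ _ _ _ _ ((amplitudeRel_iff _ _ _ _ _ _).2 ?_)
    rw [← hx k]
    refine Finset.sum_congr rfl fun i _ => ?_
    fin_cases i <;> rfl

instance finiteDimensional_sepSpace (m n p : ℕ) : FiniteDimensional ℝ (sepSpace m n p) := by
  rw [sepSpace_eq_map]
  infer_instance

/-! ### The eigenspaces -/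

theorem finite_eigenvalueN (l : ℝ) :
    {t : ℕ × ℕ × ℕ | eigenvalueN t.1 t.2.1 t.2.2 = l}.Finite := by
  obtain ⟨N, hN⟩ := exists_nat_gt l
  refine ((Set.finite_Iic N).prod ((Set.finite_Iic N).prod (Set.finite_Iic N))).subset ?_
  rintro ⟨m, n, p⟩ h
  simp only [Set.mem_ofPred_eq, eigenvalueN_eq, vfreq_sq] at h
  have hsq : ∀ k : ℕ, (k : ℝ) ≤ (k : ℝ) ^ 2 := fun k => by
    exact_mod_cast Nat.le_self_pow two_ne_zero k
  have hp : (p : ℝ) ^ 2 ≤ π ^ 2 / 4 * (p : ℝ) ^ 2 := by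
    refine le_mul_of_one_le_left (sq_nonneg _) ?_
    nlinarith [pi_gt_three]
  have hm0 := sq_nonneg (m : ℝ)
  have hn0 := sq_nonneg (n : ℝ)
  have hp0 := sq_nonneg (p : ℝ)
  refine ⟨?_, ?_, ?_⟩
  · have : (m : ℝ) < N := by linarith [hsq m]
    exact_mod_cast this.le
  · have : (n : ℝ) < N := by linarith [hsq n]
    exact_mod_cast this.le
  · have : (p : ℝ) < N := by linarith [hsq p]
    exact_mod_cast this.le

theorem weakSolutions_eq_iSup (l : ℝ) : weakSolutions l =
    ⨆ t : {t : ℕ × ℕ × ℕ // eigenvalueN t.1 t.2.1 t.2.2 = l}, sepSpace t.1.1 t.1.2.1 t.1.2.2 := by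
  have hfin : Finite {t : ℕ × ℕ × ℕ // eigenvalueN t.1 t.2.1 t.2.2 = l} :=
    (finite_eigenvalueN l).to_subtype
  set S := ⨆ t : {t : ℕ × ℕ × ℕ // eigenvalueN t.1 t.2.1 t.2.2 = l},
    sepSpace t.1.1 t.1.2.1 t.1.2.2 with hS
  have hle : S ≤ weakSolutions l := by
    refine iSup_le ?_
    rintro ⟨⟨m, n, p⟩, rfl⟩
    exact sepSpace_le_weakSolutions m n p
  refine le_antisymm (fun u hu => ?_) hle
  have hfd : FiniteDimensional ℝ S := Submodule.finite_iSup _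
  obtain ⟨s, hs, w, hw, rfl⟩ := exists_add_orthogonal S u
  have hwl : w ∈ weakSolutions l := by
    simpa using (weakSolutions l).sub_mem hu (hle hs)
  have hw0 : w = 0 := by
    -- The remainder `w` is orthogonal to fields with eigenvalue `l` by projection, and to all
    -- others as a weak solution for `l`.
    refine hwl.1.1.eq_zero_of_dot_sepL2 fun m n p a b c d U V W h => ?_
    have hmem := sepL2_mem m n p a b c d U V W h
    by_cases hl : eigenvalueN m n p = l
    · rw [dot_comm]
      exact hw _ (le_iSup (fun t : {t : ℕ × ℕ × ℕ // eigenvalueN t.1 t.2.1 t.2.2 = l} =>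
        sepSpace t.1.1 t.1.2.1 t.1.2.2) ⟨(m, n, p), hl⟩ hmem)
    · have := IsWeakSolution.inner_eq hwl (sepSpace_le_weakSolutions m n p hmem)
      exact (mul_eq_zero.1 this).resolve_left (sub_ne_zero.2 (Ne.symm hl))
  rw [hw0, add_zero]
  exact hs

/-! ### Dimensions -/

theorem fieldOfCoeffs_congr {m n p : ℕ} {x y : Fin 3 → Fin 4 → ℝ}
    (h0 : ∀ X, basicField m n p (x 0 0) (x 0 1) (x 0 2) (x 0 3) 0 X =
      basicField m n p (y 0 0) (y 0 1) (y 0 2) (y 0 3) 0 X)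
    (h1 : ∀ X, basicField m n p (x 1 0) (x 1 1) (x 1 2) (x 1 3) 1 X =
      basicField m n p (y 1 0) (y 1 1) (y 1 2) (y 1 3) 1 X)
    (h2 : ∀ X, basicField m n p (x 2 0) (x 2 1) (x 2 2) (x 2 3) 2 X =
      basicField m n p (y 2 0) (y 2 1) (y 2 2) (y 2 3) 2 X) :
    fieldOfCoeffs m n p x = fieldOfCoeffs m n p y := by
  funext i
  refine congrArg toL2 (funext fun X => ?_)
  fin_cases i
  · exact h0 X
  · exact h1 X
  · exact h2 X

/-- When an index is zero, coefficients multiplying `sin 0` are invisible and `fieldOfCoeffs` has a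
kernel. The map `j` parametrises only visible, independent coefficients. -/
theorem finrank_sepSpace_eq {m n p : ℕ} {E : Type*} [AddCommGroup E] [Module ℝ E]
    (j : E →ₗ[ℝ] Fin 3 → Fin 4 → ℝ) (hmem : ∀ α, j α ∈ relCoeffs m n p)
    (hinj : ∀ α, fieldOfCoeffs m n p (j α) = 0 → α = 0)
    (hsurj : ∀ x ∈ relCoeffs m n p, ∃ α, fieldOfCoeffs m n p x = fieldOfCoeffs m n p (j α)) :
    Module.finrank ℝ (sepSpace m n p) = Module.finrank ℝ E := by
  have h1 : sepSpace m n p = LinearMap.range ((fieldOfCoeffs m n p).comp j) := by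
    rw [sepSpace_eq_map]
    ext u
    constructor
    · rintro ⟨x, hx, rfl⟩
      obtain ⟨α, hα⟩ := hsurj x hx
      exact ⟨α, hα.symm⟩
    · rintro ⟨α, rfl⟩
      exact ⟨j α, hmem α, rfl⟩
  rw [h1]
  exact LinearMap.finrank_range_of_inj ((injective_iff_map_eq_zero _).2 hinj)

/-- Evaluation at `x ∈ {0, π / (2m)}` and `y ∈ {0, π / (2n)}` isolates one coefficient at a time. -/
theorem mode_coeffs {m n : ℕ} {f : ℝ → ℝ} {z : ℝ} (hz : z ∈ Set.Icc (-1 : ℝ) 1) (hfz : f z ≠ 0)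
    {a b c d : ℝ} (h : ∀ X ∈ cell, mode m n f a b c d X = 0) :
    c = 0 ∧ (m ≠ 0 → d = 0) ∧ (n ≠ 0 → b = 0) ∧ (m ≠ 0 → n ≠ 0 → a = 0) := by
  have hpi := pi_pos
  have hmem : ∀ k : ℕ, k ≠ 0 → π / 2 / k ∈ Set.Icc 0 (2 * π) := by
    intro k hk
    have hk1 : (1 : ℝ) ≤ k := by exact_mod_cast Nat.one_le_iff_ne_zero.2 hk
    refine ⟨by positivity, (div_le_self (by positivity) hk1).trans (by linarith)⟩
  have hmul : ∀ k : ℕ, k ≠ 0 → (k : ℝ) * (π / 2 / k) = π / 2 := by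
    intro k hk
    have : (k : ℝ) ≠ 0 := by exact_mod_cast hk
    field_simp
  have h0 : (0 : ℝ) ∈ Set.Icc 0 (2 * π) := ⟨le_rfl, by positivity⟩
  have key : ∀ x ∈ Set.Icc 0 (2 * π), ∀ y ∈ Set.Icc 0 (2 * π), Pw m n a b c d x y = 0 :=
    fun x hx y hy => (mul_eq_zero.1 (h (x, y, z) ⟨hx, hy, hz⟩)).resolve_left hfz
  refine ⟨?_, fun hm => ?_, fun hn => ?_, fun hm hn => ?_⟩
  · simpa [Pw] using key 0 h0 0 h0
  · simpa [Pw, hmul m hm] using key _ (hmem m hm) 0 h0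
  · simpa [Pw, hmul n hn] using key 0 h0 _ (hmem n hn)
  · simpa [Pw, hmul m hm, hmul n hn] using key _ (hmem m hm) _ (hmem n hn)

theorem inv_mem_Icc (p : ℕ) : (1 / p : ℝ) ∈ Set.Icc (-1 : ℝ) 1 := by
  rcases Nat.eq_zero_or_pos p with rfl | hp
  · simp
  · have : (1 : ℝ) ≤ p := by exact_mod_cast hp
    refine ⟨by linarith [show (0 : ℝ) ≤ 1 / p by positivity], ?_⟩
    rw [div_le_one (by positivity)]
    exact this

theorem exists_hProfile_ne_zero (p : ℕ) : ∃ z ∈ Set.Icc (-1 : ℝ) 1, hProfile p z ≠ 0 := by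
  by_cases h : Even p
  · exact ⟨0, by norm_num, by simp [hProfile, h]⟩
  · refine ⟨1 / p, inv_mem_Icc p, ?_⟩
    have hp : (p : ℝ) ≠ 0 := by
      rintro h0
      rw [Nat.cast_eq_zero] at h0
      exact h (by simp [h0])
    rw [hProfile, if_neg h, mul_assoc, mul_one_div_cancel hp, mul_one, sin_pi_div_two]
    exact one_ne_zero

theorem exists_vProfile_ne_zero {p : ℕ} (hp : p ≠ 0) :
    ∃ z ∈ Set.Icc (-1 : ℝ) 1, vProfile p z ≠ 0 := by
  by_cases h : Even p
  · refine ⟨1 / p, inv_mem_Icc p, ?_⟩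
    have hp : (p : ℝ) ≠ 0 := by exact_mod_cast hp
    rw [vProfile, if_pos h, mul_assoc, mul_one_div_cancel hp, mul_one, sin_pi_div_two]
    exact one_ne_zero
  · exact ⟨0, by norm_num, by simp [vProfile, h]⟩

theorem coeffs_of_fieldOfCoeffs_eq_zero {m n p : ℕ} {x : Fin 3 → Fin 4 → ℝ}
    (h : fieldOfCoeffs m n p x = 0) :
    (x 0 3 = 0 ∧ (m ≠ 0 → x 0 2 = 0) ∧ (n ≠ 0 → x 0 0 = 0) ∧ (m ≠ 0 → n ≠ 0 → x 0 1 = 0)) ∧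
    (x 1 1 = 0 ∧ (m ≠ 0 → x 1 0 = 0) ∧ (n ≠ 0 → x 1 2 = 0) ∧ (m ≠ 0 → n ≠ 0 → x 1 3 = 0)) ∧
    (p ≠ 0 →
      x 2 2 = 0 ∧ (m ≠ 0 → x 2 3 = 0) ∧ (n ≠ 0 → x 2 1 = 0) ∧ (m ≠ 0 → n ≠ 0 → x 2 0 = 0)) := by
  have key : ∀ i, ∀ X ∈ cell, basicField m n p (x i 0) (x i 1) (x i 2) (x i 3) i X = 0 := fun i =>
    toL2_eq_zero (isSmooth_basicField ..).continuous (congrFun h i)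
  obtain ⟨z, hz, hfz⟩ := exists_hProfile_ne_zero p
  refine ⟨?_, ?_, fun hp => ?_⟩
  · simpa only [neg_eq_zero] using mode_coeffs hz hfz (key 0)
  · simpa only [neg_eq_zero] using mode_coeffs hz hfz (key 1)
  · obtain ⟨z, hz, hfz⟩ := exists_vProfile_ne_zero hp
    exact mode_coeffs hz hfz (key 2)

theorem vMode_zero (m n : ℕ) (a b c d : ℝ) (X : Pt) : mode m n (vProfile 0) a b c d X = 0 := by
  simp [mode, vProfile]

theorem finrank_sepSpace_zero_zero (p : ℕ) : Module.finrank ℝ (sepSpace 0 0 p) = 2 := by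
  let j : (Fin 2 → ℝ) →ₗ[ℝ] Fin 3 → Fin 4 → ℝ :=
    { toFun := fun α => ![![0, 0, 0, α 0], ![0, α 1, 0, 0], 0]
      map_add' := fun α β => by
        ext i k; fin_cases i <;> fin_cases k <;> simp
      map_smul' := fun r α => by
        ext i k; fin_cases i <;> fin_cases k <;> simp }
  rw [finrank_sepSpace_eq j, Module.finrank_fin_fun]
  · intro α
    rw [mem_relCoeffs]
    intro k
    simp [j]
  · intro α h
    obtain ⟨h0, h1, -⟩ := coeffs_of_fieldOfCoeffs_eq_zero h
    funext i
    fin_cases i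
    · exact h0.1
    · exact h1.1
  · intro x hx
    rw [mem_relCoeffs] at hx
    refine ⟨![x 0 3, x 1 1], fieldOfCoeffs_congr (fun X => ?_) (fun X => ?_) fun X => ?_⟩
    · simp [basicField, mode, Pw, j]
    · simp [basicField, mode, Pw, j]
    · change mode 0 0 (vProfile p) _ _ _ _ X = mode 0 0 (vProfile p) _ _ _ _ X
      rcases Nat.eq_zero_or_pos p with rfl | hp
      · rw [vMode_zero, vMode_zero]
      · have h2 : x 2 2 = 0 := by
          have := hx 2
          simp only [Nat.cast_zero, zero_mul, add_zero] at this
          exact (mul_eq_zero.1 this.symm).resolve_left (vfreq_eq_zero.not.2 hp.ne')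
        simp [mode, Pw, j, h2]

/-- The relation forces the first component to vanish and the vertical profile is `sin 0`; the
second component has two visible coefficients. -/
theorem finrank_sepSpace_x_zero {m : ℕ} (hm : m ≠ 0) :
    Module.finrank ℝ (sepSpace m 0 0) = 2 := by
  let j : (Fin 2 → ℝ) →ₗ[ℝ] Fin 3 → Fin 4 → ℝ :=
    { toFun := fun α => ![0, ![α 0, α 1, 0, 0], 0]
      map_add' := fun α β => by
        ext i k; fin_cases i <;> fin_cases k <;> simp
      map_smul' := fun r α => by
        ext i k; fin_cases i <;> fin_cases k <;> simp }
  have hv := vfreq_eq_zero.2 (rfl : 0 = 0)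
  have hm' : (m : ℝ) ≠ 0 := by exact_mod_cast hm
  rw [finrank_sepSpace_eq j, Module.finrank_fin_fun]
  · intro α
    rw [mem_relCoeffs]
    intro k
    simp [j]
  · intro α h
    obtain ⟨-, h1, -⟩ := coeffs_of_fieldOfCoeffs_eq_zero h
    funext i
    fin_cases i
    · exact h1.2.1 hm
    · exact h1.1
  · intro x hx
    rw [mem_relCoeffs] at hx
    have h0 : ∀ k, x 0 k = 0 := fun k => by simpa [hv, hm'] using hx k
    refine ⟨![x 1 0, x 1 1], fieldOfCoeffs_congr (fun X => ?_) (fun X => ?_) fun X => ?_⟩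
    · simp [basicField, mode, Pw, j, h0]
    · simp [basicField, mode, Pw, j]
    · exact (vMode_zero ..).trans (vMode_zero ..).symm

theorem finrank_sepSpace_zero_y {n : ℕ} (hn : n ≠ 0) :
    Module.finrank ℝ (sepSpace 0 n 0) = 2 := by
  let j : (Fin 2 → ℝ) →ₗ[ℝ] Fin 3 → Fin 4 → ℝ :=
    { toFun := fun α => ![![α 0, 0, 0, α 1], 0, 0]
      map_add' := fun α β => by
        ext i k; fin_cases i <;> fin_cases k <;> simp
      map_smul' := fun r α => by
        ext i k; fin_cases i <;> fin_cases k <;> simp }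
  have hv := vfreq_eq_zero.2 (rfl : 0 = 0)
  have hn' : (n : ℝ) ≠ 0 := by exact_mod_cast hn
  rw [finrank_sepSpace_eq j, Module.finrank_fin_fun]
  · intro α
    rw [mem_relCoeffs]
    intro k
    simp [j]
  · intro α h
    obtain ⟨h0, -, -⟩ := coeffs_of_fieldOfCoeffs_eq_zero h
    funext i
    fin_cases i
    · exact h0.2.2.1 hn
    · exact h0.1
  · intro x hx
    rw [mem_relCoeffs] at hx
    have h1 : ∀ k, x 1 k = 0 := fun k => by simpa [hv, hn'] using hx k
    refine ⟨![x 0 0, x 0 3], fieldOfCoeffs_congr (fun X => ?_) (fun X => ?_) fun X => ?_⟩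
    · simp [basicField, mode, Pw, j]
    · simp [basicField, mode, Pw, j, h1]
    · exact (vMode_zero ..).trans (vMode_zero ..).symm

/-- The relation determines the first component from the third; the second and third contribute two
visible coefficients each. -/
theorem finrank_sepSpace_x_z {m p : ℕ} (hm : m ≠ 0) (hp : p ≠ 0) :
    Module.finrank ℝ (sepSpace m 0 p) = 4 := by
  have hv := vfreq_eq_zero.not.2 hp
  have hm' : (m : ℝ) ≠ 0 := by exact_mod_cast hm
  let j : (Fin 4 → ℝ) →ₗ[ℝ] Fin 3 → Fin 4 → ℝ :=
    { toFun := fun α => ![![0, 0, vfreq p * α 2 / m, vfreq p * α 3 / m], ![α 0, α 1, 0, 0],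
        ![0, 0, α 2, α 3]]
      map_add' := fun α β => by
        ext i k; fin_cases i <;> fin_cases k <;> simp [mul_add, add_div]
      map_smul' := fun r α => by
        ext i k; fin_cases i <;> fin_cases k <;> simp [mul_left_comm, mul_div_assoc] }
  rw [finrank_sepSpace_eq j, Module.finrank_fin_fun]
  · intro α
    rw [mem_relCoeffs]
    intro k
    fin_cases k <;> simp [j, mul_div_cancel₀, hm']
  · intro α h
    obtain ⟨-, h1, h2⟩ := coeffs_of_fieldOfCoeffs_eq_zero h
    funext i
    fin_cases i
    · exact h1.2.1 hm
    · exact h1.1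
    · exact (h2 hp).1
    · exact (h2 hp).2.1 hm
  · intro x hx
    rw [mem_relCoeffs] at hx
    have h0 : ∀ k, vfreq p * x 2 k / m = x 0 k := fun k => by
      have := hx k
      rw [div_eq_iff hm']
      simp only [Nat.cast_zero, zero_mul, add_zero] at this
      rw [← this, mul_comm]
    refine ⟨![x 1 0, x 1 1, x 2 2, x 2 3], fieldOfCoeffs_congr (fun X => ?_) (fun X => ?_) fun X => ?_⟩
    · simp [basicField, mode, Pw, j, h0]
    · simp [basicField, mode, Pw, j]
    · simp [basicField, mode, Pw, j]

theorem finrank_sepSpace_y_z {n p : ℕ} (hn : n ≠ 0) (hp : p ≠ 0) :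
    Module.finrank ℝ (sepSpace 0 n p) = 4 := by
  have hv := vfreq_eq_zero.not.2 hp
  have hn' : (n : ℝ) ≠ 0 := by exact_mod_cast hn
  let j : (Fin 4 → ℝ) →ₗ[ℝ] Fin 3 → Fin 4 → ℝ :=
    { toFun := fun α => ![![α 0, 0, 0, α 1], ![0, vfreq p * α 2 / n, vfreq p * α 3 / n, 0],
        ![0, α 2, α 3, 0]]
      map_add' := fun α β => by
        ext i k; fin_cases i <;> fin_cases k <;> simp [mul_add, add_div]
      map_smul' := fun r α => by
        ext i k; fin_cases i <;> fin_cases k <;> simp [mul_left_comm, mul_div_assoc] }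
  rw [finrank_sepSpace_eq j, Module.finrank_fin_fun]
  · intro α
    rw [mem_relCoeffs]
    intro k
    fin_cases k <;> simp [j, mul_div_cancel₀, hn']
  · intro α h
    obtain ⟨h0, -, h2⟩ := coeffs_of_fieldOfCoeffs_eq_zero h
    funext i
    fin_cases i
    · exact h0.2.2.1 hn
    · exact h0.1
    · exact (h2 hp).2.2.1 hn
    · exact (h2 hp).1
  · intro x hx
    rw [mem_relCoeffs] at hx
    have h1 : ∀ k, vfreq p * x 2 k / n = x 1 k := fun k => by
      have := hx k
      rw [div_eq_iff hn']
      simp only [Nat.cast_zero, zero_mul, zero_add] at this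
      rw [← this, mul_comm]
    refine ⟨![x 0 0, x 0 3, x 2 1, x 2 2], fieldOfCoeffs_congr (fun X => ?_) (fun X => ?_) fun X => ?_⟩
    · simp [basicField, mode, Pw, j]
    · simp [basicField, mode, Pw, j, h1]
    · simp [basicField, mode, Pw, j]

/-- With no vertical component, the amplitudes are proportional to `(n, -m)`, for each of the four
coefficients. -/
theorem finrank_sepSpace_x_y {m n : ℕ} (hm : m ≠ 0) (hn : n ≠ 0) :
    Module.finrank ℝ (sepSpace m n 0) = 4 := by
  have hv := vfreq_eq_zero.2 (rfl : 0 = 0)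
  have hm' : (m : ℝ) ≠ 0 := by exact_mod_cast hm
  have hn' : (n : ℝ) ≠ 0 := by exact_mod_cast hn
  let j : (Fin 4 → ℝ) →ₗ[ℝ] Fin 3 → Fin 4 → ℝ :=
    { toFun := fun α => ![fun k => n * α k, fun k => -(m * α k), 0]
      map_add' := fun α β => by
        ext i k; fin_cases i <;> simp [mul_add, add_comm]
      map_smul' := fun r α => by
        ext i k; fin_cases i <;> simp [mul_left_comm] }
  rw [finrank_sepSpace_eq j, Module.finrank_fin_fun]
  · intro α
    rw [mem_relCoeffs]
    intro k
    simp only [j, LinearMap.coe_mk, AddHom.coe_mk, Matrix.cons_val_zero, Matrix.cons_val_one,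
      Matrix.cons_val_two, Matrix.tail_cons, Matrix.head_cons, hv, zero_mul]
    ring
  · intro α h
    obtain ⟨h0, -, -⟩ := coeffs_of_fieldOfCoeffs_eq_zero h
    funext i
    refine (mul_eq_zero.1 (?_ : (n : ℝ) * α i = 0)).resolve_left hn'
    fin_cases i
    · exact h0.2.2.1 hn
    · exact h0.2.2.2 hm hn
    · exact h0.2.1 hm
    · exact h0.1
  · intro x hx
    rw [mem_relCoeffs] at hx
    have h0 : ∀ k, n * (x 0 k / n) = x 0 k := fun k => mul_div_cancel₀ _ hn'
    have h1 : ∀ k, -(m * (x 0 k / n)) = x 1 k := fun k => by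
      have := hx k
      rw [hv, zero_mul] at this
      field_simp
      linarith
    refine ⟨fun k => x 0 k / n, fieldOfCoeffs_congr (fun X => ?_) (fun X => ?_) fun X => ?_⟩
    · simp [basicField, j, h0]
    · simp [basicField, j, h1]
    · exact (vMode_zero ..).trans (vMode_zero ..).symm

/-- The two horizontal components are free and the relation determines the vertical one. -/
theorem finrank_sepSpace_of_ne_zero {m n p : ℕ} (hm : m ≠ 0) (hn : n ≠ 0) (hp : p ≠ 0) :
    Module.finrank ℝ (sepSpace m n p) = 8 := by
  have hv := vfreq_eq_zero.not.2 hp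
  let j : (Fin 4 → ℝ) × (Fin 4 → ℝ) →ₗ[ℝ] Fin 3 → Fin 4 → ℝ :=
    { toFun := fun α => ![α.1, α.2, fun k => (m * α.1 k + n * α.2 k) / vfreq p]
      map_add' := fun α β => by
        ext i k
        fin_cases i
        · rfl
        · rfl
        · simp
          ring
      map_smul' := fun r α => by
        ext i k
        fin_cases i
        · rfl
        · rfl
        · simp
          ring }
  rw [finrank_sepSpace_eq j, Module.finrank_prod, Module.finrank_fin_fun]
  · intro α
    rw [mem_relCoeffs]
    intro k
    simp [j, mul_div_cancel₀, hv]
  · intro α h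
    obtain ⟨h0, h1, -⟩ := coeffs_of_fieldOfCoeffs_eq_zero h
    ext i
    · fin_cases i
      · exact h0.2.2.1 hn
      · exact h0.2.2.2 hm hn
      · exact h0.2.1 hm
      · exact h0.1
    · fin_cases i
      · exact h1.2.1 hm
      · exact h1.1
      · exact h1.2.2.1 hn
      · exact h1.2.2.2 hm hn
  · intro x hx
    rw [mem_relCoeffs] at hx
    refine ⟨(x 0, x 1), fieldOfCoeffs_congr (fun X => ?_) (fun X => ?_) fun X => ?_⟩
    · simp [j]
    · simp [j]
    · simp [j, hx, mul_div_cancel_left₀, hv]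

theorem finrank_sepSpace (m n p : ℕ) : Module.finrank ℝ (sepSpace m n p) = multN m n p := by
  by_cases hm : m = 0 <;> by_cases hn : n = 0
  · subst hm hn
    simp [multN, finrank_sepSpace_zero_zero]
  · subst hm
    by_cases hp : p = 0
    · subst hp
      simp [multN, hn, finrank_sepSpace_zero_y]
    · simp [multN, hn, hp, finrank_sepSpace_y_z]
  · subst hn
    by_cases hp : p = 0
    · subst hp
      simp [multN, hm, finrank_sepSpace_x_zero]
    · simp [multN, hm, hp, finrank_sepSpace_x_z]
  · by_cases hp : p = 0
    · subst hp
      simp [multN, hm, hn, finrank_sepSpace_x_y]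
    · simp [multN, hm, hn, hp, finrank_sepSpace_of_ne_zero]

theorem isEigenvalue_eigenvalueN (m n p : ℕ) : IsEigenvalue (eigenvalueN m n p) := by
  have hpos : 0 < Module.finrank ℝ (sepSpace m n p) := by
    rw [finrank_sepSpace, multN]
    split_ifs <;> norm_num
  obtain ⟨u, hu⟩ := (Module.finrank_pos_iff_exists_ne_zero (R := ℝ)).1 hpos
  exact ⟨u, fun h => hu (Subtype.ext h), sepSpace_le_weakSolutions m n p u.2⟩

theorem exists_eq_eigenvalueN {l : ℝ} (h : IsEigenvalue l) : ∃ m n p, l = eigenvalueN m n p := by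
  obtain ⟨u, hu, hul⟩ := h
  by_contra! hne
  have hempty : IsEmpty {t : ℕ × ℕ × ℕ // eigenvalueN t.1 t.2.1 t.2.2 = l} :=
    ⟨fun t => hne _ _ _ t.2.symm⟩
  have hmem : u ∈ weakSolutions l := hul
  rw [weakSolutions_eq_iSup, iSup_of_empty, Submodule.mem_bot] at hmem
  exact hu hmem

/-! ### The pressure -/

/-- After subtraction of the mean, all Fourier coefficients vanish: every nonconstant horizontal
mode is a nonzero multiple of a partial derivative of a mode without boundary term. For `m = n = 0`
that mode has the vertical profile, zero on `Γ`. -/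
theorem exists_ae_eq_const {q : L2} (h : ∀ i, IsWeakPartial i q 0) :
    ∃ Q : ℝ, q =ᵐ[volΩ] fun _ => Q := by
  have h1c : Continuous fun _ : Pt => (1 : ℝ) := continuous_const
  set o : L2 := toL2 fun _ => 1 with ho
  have hoo : inner ℝ o o ≠ 0 := by
    intro h0
    have := toL2_eq_zero h1c (inner_self_eq_zero.1 h0) (0, 0, 0)
      ⟨⟨le_rfl, by positivity⟩, ⟨le_rfl, by positivity⟩, by norm_num⟩
    exact one_ne_zero this
  set Q : ℝ := inner ℝ q o / inner ℝ o o with hQ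
  have hpo : ∀ i, IsWeakPartial i o 0 := by
    intro i
    have h2 := isWeakPartial_toL2 i (isSmooth_const 1)
    rwa [pd_const, show toL2 (fun _ : Pt => (0 : ℝ)) = 0 from
      (eq_toL2 continuous_const (Lp.coeFn_zero ℝ 2 volΩ)).symm] at h2
  set r : L2 := q + (-Q) • o with hr
  have hpr : ∀ i, IsWeakPartial i r 0 := fun i => by
    simpa only [smul_zero, add_zero] using (h i).add ((hpo i).smul (-Q))
  have hint : ∀ (i : Fin 3) {F G : Pt → ℝ} {k : ℝ}, IsSmooth F → NoBoundaryTerm i F → k ≠ 0 →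
      (pd i F = fun X => k * G X) → ∫ X, r X * G X ∂volΩ = 0 := by
    intro i F G k hF hb hk hFG
    have h2 := (hpr i).integral_mul_pd hF hb
    rw [integral_zero_L2 hF.continuous, neg_zero, hFG] at h2
    simp only [mul_left_comm _ k, integral_const_mul] at h2
    exact (mul_eq_zero.1 h2).resolve_left hk
  have hr0 : r = 0 := by
    refine L2_eq_zero_of_hModes fun m n p a b c d => ?_
    by_cases hm : m = 0
    · by_cases hn : n = 0
      · by_cases hp : p = 0
        · subst hm hn hp
          have h2 : inner ℝ r o = 0 := by
            rw [hr, inner_add_left, inner_smul_left, RCLike.conj_to_real, hQ]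
            field_simp
            ring
          rw [ho, inner_toL2 _ h1c] at h2
          have h3 : mode 0 0 (hProfile 0) a b c d = fun _ => c * 1 := by
            funext X
            simp [mode, hProfile, Pw]
          simp only [h3, mul_left_comm _ c, integral_const_mul, h2, mul_zero]
        · exact hint 2 (isSmooth_mode m n (contDiff_vProfile p) a b c d)
            (fun _ X hX => vMode_eq_zero m n p a b c d hX) (vfreq_eq_zero.not.2 hp)
            (pd_two_mode m n (contDiff_vProfile p) _ (hasDerivAt_vProfile p) a b c d)
      · refine hint 1 (isSmooth_hMode m n p d c (-b) (-a)) (noBoundaryTerm_of_ne (by decide) _)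
          (Nat.cast_ne_zero.2 hn) ?_
        simpa using pd_one_mode m n (contDiff_hProfile p) d c (-b) (-a)
    · refine hint 0 (isSmooth_hMode m n p b (-a) (-d) c) (noBoundaryTerm_of_ne (by decide) _)
        (Nat.cast_ne_zero.2 hm) ?_
      simpa using pd_zero_mode m n (contDiff_hProfile p) b (-a) (-d) c
  refine ⟨Q, ?_⟩
  have hq : q = toL2 fun _ => Q * 1 := by
    rw [toL2_const_mul Q h1c, ← ho, ← sub_eq_zero, sub_eq_add_neg, ← neg_smul, ← hr, hr0]
  rw [hq]
  simpa using coeFn_toL2 (f := fun _ : Pt => Q * 1) continuous_const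

/-- As a sum of separated fields, `u` already satisfies `-Δu = l u` in the sense of distributions,
so the pressure equation reduces to `∇q = 0`. -/
theorem isPressure_iff {l : ℝ} {u : L2Field} (hu : IsWeakSolution l u) (q : L2) :
    IsPressure l u q ↔ ∃ Q : ℝ, q =ᵐ[volΩ] fun _ => Q := by
  have hvw : u ∈ veryWeakSolutions l := by
    have hmem : u ∈ weakSolutions l := hu
    rw [weakSolutions_eq_iSup] at hmem
    refine (iSup_le ?_ : (⨆ t : {t : ℕ × ℕ × ℕ // eigenvalueN t.1 t.2.1 t.2.2 = l},
      sepSpace t.1.1 t.1.2.1 t.1.2.2) ≤ _) hmem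
    rintro ⟨⟨m, n, p⟩, rfl⟩
    exact sepSpace_le_veryWeakSolutions m n p
  have hiff : IsPressure l u q ↔ ∀ φ : Fin 3 → Pt → ℝ, (∀ i, IsTest (φ i)) →
      ∫ X, q X * (∑ i, pd i (φ i) X) ∂volΩ = 0 := by
    refine forall_congr' fun φ => forall_congr' fun hφ => ?_
    rw [hvw φ hφ]
    constructor <;> intro h <;> linarith
  rw [hiff]
  constructor
  · intro h
    refine exists_ae_eq_const fun i ψ hψ => ?_
    rw [integral_zero_L2 hψ.1.continuous, neg_zero]
    -- A test field with a single nonzero component isolates one partial derivative of `q`.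
    have h1 := h (fun j => if j = i then ψ else fun _ => 0) fun j => by
      split_ifs
      · exact hψ
      · exact isTest_zero
    rw [← h1]
    congr 1
    funext X
    rw [Finset.sum_eq_single i, if_pos rfl]
    · intro j _ hj
      rw [if_neg hj, pd_const]
    · simp
  · rintro ⟨Q, hQ⟩ φ hφ
    have h1 : ∫ X, q X * (∑ i, pd i (φ i) X) ∂volΩ = ∫ X, Q * (∑ i, pd i (φ i) X) ∂volΩ := by
      refine integral_congr_ae ?_
      filter_upwards [hQ] with X hX
      rw [hX]
    rw [h1, integral_const_mul, integral_finsetSum _ fun i _ =>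
      integrable_of_continuous ((hφ i).1.pd i).continuous,
      Finset.sum_eq_zero fun i _ => integral_pd_eq_zero i (hφ i).1 fun _ X hX =>
        (hφ i).eq_zero hX, mul_zero]

/-! ### The sequences of eigenvalues -/

theorem eigenvalueN_nonneg (m n p : ℕ) : 0 ≤ eigenvalueN m n p := by
  rw [eigenvalueN]
  positivity

theorem strictMono_eigenvalueN (m n : ℕ) : StrictMono (eigenvalueN m n) := by
  intro p q hpq
  have h : (p : ℝ) < q := by exact_mod_cast hpq
  simp only [eigenvalueN]
  gcongr

theorem tendsto_eigenvalueN (m n : ℕ) : Tendsto (eigenvalueN m n) atTop atTop := by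
  refine tendsto_atTop_add_const_left _ _ (Tendsto.const_mul_atTop (by positivity) ?_)
  exact (tendsto_pow_atTop two_ne_zero).comp tendsto_natCast_atTop_atTop

end StokesChannel

open StokesChannel
theorem corollary3p3 :
    -- for all `m, n`: a nonnegative, increasing, diverging sequence of eigenvalues
    (∀ m n : ℕ, (∀ p, 0 ≤ eigenvalueN m n p ∧ IsEigenvalue (eigenvalueN m n p)) ∧
      StrictMono (eigenvalueN m n) ∧ Tendsto (eigenvalueN m n) atTop atTop) ∧
    -- there are no other eigenvalues
    (∀ l : ℝ, IsEigenvalue l ↔ ∃ m n p : ℕ, l = eigenvalueN m n p) ∧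
    -- each eigenspace is spanned by separated fields with trigonometric profiles
    (∀ l : ℝ, {u : L2Field | IsWeakSolution l u} =
      ((⨆ t : {t : ℕ × ℕ × ℕ // eigenvalueN t.1 t.2.1 t.2.2 = l},
        sepSpace t.1.1 t.1.2.1 t.1.2.2 : Submodule ℝ L2Field) : Set L2Field)) ∧
    -- multiplicities: the sum of these spaces is direct, with summands of known dimension
    iSupIndep (fun t : ℕ × ℕ × ℕ => sepSpace t.1 t.2.1 t.2.2) ∧
    (∀ l : ℝ, {t : ℕ × ℕ × ℕ | eigenvalueN t.1 t.2.1 t.2.2 = l}.Finite) ∧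
    (∀ m n p : ℕ, Module.finrank ℝ (sepSpace m n p) = multN m n p) ∧
    -- the pressures are exactly the constants
    (∀ (l : ℝ) (u : L2Field), IsEigenfunction l u → ∀ q : L2,
      IsPressure l u q ↔ ∃ Q : ℝ, q =ᵐ[volΩ] fun _ => Q) ∧
    -- the separated fields, with constant pressure, solve the problem pointwise
    (∀ (m n p : ℕ) (a b c d U V W Q : ℝ), AmplitudeRel m n p U V W →
      IsClassicalSolution 0 (eigenvalueN m n p) (sepField m n p a b c d U V W) (fun _ => Q)) := by
  refine ⟨fun m n => ⟨fun p => ⟨eigenvalueN_nonneg m n p, isEigenvalue_eigenvalueN m n p⟩,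
    strictMono_eigenvalueN m n, tendsto_eigenvalueN m n⟩, fun l => ⟨exists_eq_eigenvalueN, ?_⟩,
    fun l => ?_, iSupIndep_sepSpace, finite_eigenvalueN, finrank_sepSpace,
    fun l u hu => isPressure_iff hu.2, isClassicalSolution_sepField⟩
  · rintro ⟨m, n, p, rfl⟩
    exact isEigenvalue_eigenvalueN m n p
  · rw [← weakSolutions_eq_iSup]
    rfl
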